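/- Let $M$ be a connected complete Riemannian manifold of dimension $n$ (smooth, without boundary, with a smooth metric), and let $V, W_1,\dots,W_n : M\to\mathbb{R}$ be functions of class $C^2$. Consider on the cotangent bundle $T^*M$ the control system $\dot\lambda(t)=\vec H_{u(t)}(\lambda(t))$, where $\vec H_c$ denotes, for $c\in\mathbb{R}^n$, the Hamiltonian vector field (with respect to the canonical symplectic structure; in canonical coordinates $\dot x^i=\partial H_c/\partial p_i$, $\dot p_i=-\partial H_c/\partial x^i$) of $$H_c(x,p)=\tfrac12\|p\|^2+V(x)+\sum_{i=1}^n c_i W_i(x),$$ $\|\cdot\|$ being the norm on covectors induced by the Riemannian metric. The admissible controls $u=(u_1,\dots,u_n)$ are the piecewise constant functions with values in $\mathbb{R}^n$, and a solution is a continuous curve that satisfies the equation outside a finite set of times. For $T\ge 0$ and $\lambda_0\in T^*M$ let $\mathcal{A}_{\le T}(\lambda_0)\subset T^*M$ be the set of all $\lambda(s)$, where $0\le s\le T$ and $\lambda:[0,s]\to T^*M$ is a solution for some admissible control with $\lambda(0)=\lambda_0$. Put $$T_c=\inf\Big\{T\ge 0 \;:\; \text{there is a dense set } \Upsilon\subset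 T^*M \text{ such that } \overline{\mathcal{A}_{\le T}(\lambda_0)}=T^*M \text{ for all } \lambda_0\in\Upsilon\Big\}\in[0,\infty],$$ with $\inf\emptyset=\infty$. The system is called small-time CA-controllable if $T_c=0$. Let $$O=\{x\in M \;:\; (dW_1\wedge\cdots\wedge dW_n)(x)=0\}.$$ 1. If $O$ has empty interior, then the system is small-time CA-controllable. 2. If $n=1$, the converse also holds: if the system is small-time CA-controllable, then $O$ has empty interior. -/

import Mathlib

open Set Bundle Manifold
open scoped ContDiff Topology NNReal ENNReal

/-- The cotangent bundle `T^*M` of an `n`-dimensional manifold `M`, with the topology and the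
manifold structure of the bundle of continuous linear maps from `TM` to the trivial line bundle.
Points are written `z = ⟨x, p⟩` with `x = z.proj` and `p = z.2` a covector at `x`. The chart around
`⟨x₀, p₀⟩` is the system of canonical coordinates `(x, p) ↦ (q, ξ)` induced by the chart of `M`
at `x₀`, so that `p = ∑ ξ_i dq^i`. -/
abbrev CotangentBundle (n : ℕ) (M : Type*) [TopologicalSpace M]
    [ChartedSpace (EuclideanSpace ℝ (Fin n)) M] [IsManifold (𝓡 n) ∞ M] : Type _ :=
  TotalSpace (EuclideanSpace ℝ (Fin n) →L[ℝ] ℝ) (fun x : M => TangentSpace (𝓡 n) x →L[ℝ] ℝ)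

/-- The model with corners of the manifold `T^*M`. -/
noncomputable abbrev cotangentModel (n : ℕ) :=
  (𝓡 n).prod 𝓘(ℝ, EuclideanSpace ℝ (Fin n) →L[ℝ] ℝ)

/-- The Hamiltonian vector field of a function `H` on `T^*M`. The tangent space of `T^*M` at `z` is
represented by Mathlib in the chart of `T^*M` at `z`, that is, in canonical coordinates `(q, ξ)`;
in these coordinates the field is
`(∂H/∂ξ_1, …, ∂H/∂ξ_n, - ∂H/∂q)`, as in Hamilton's equations
`q̇^i = ∂H/∂ξ_i`, `ξ̇_i = - ∂H/∂q^i`. -/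
noncomputable def hamiltonianVectorField {n : ℕ} {M : Type*} [TopologicalSpace M]
    [ChartedSpace (EuclideanSpace ℝ (Fin n)) M] [IsManifold (𝓡 n) ∞ M]
    (H : CotangentBundle n M → ℝ) (z : CotangentBundle n M) :
    TangentSpace (cotangentModel n) z :=
  let dH : EuclideanSpace ℝ (Fin n) × (EuclideanSpace ℝ (Fin n) →L[ℝ] ℝ) →L[ℝ] ℝ :=
    mvfderiv (cotangentModel n) H z
  ((WithLp.toLp 2 fun i => dH (0, EuclideanSpace.proj i),
      -(dH.comp (ContinuousLinearMap.inl ℝ _ _))) :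
    EuclideanSpace ℝ (Fin n) × (EuclideanSpace ℝ (Fin n) →L[ℝ] ℝ))

/-- The Hamiltonian `‖p‖² / 2 + V(x) + ∑ i, c_i W_i(x)` on `T^*M` for the constant control value
`c`; here `‖p‖` is the norm of the covector `p` dual to the Riemannian norm of `T_xM`. -/
noncomputable def controlHamiltonian {n : ℕ} {M : Type*} [TopologicalSpace M]
    [ChartedSpace (EuclideanSpace ℝ (Fin n)) M] [IsManifold (𝓡 n) ∞ M]
    [RiemannianBundle (fun x : M => TangentSpace (𝓡 n) x)]
    (V : M → ℝ) (W : Fin n → M → ℝ) (c : Fin n → ℝ) (z : CotangentBundle n M) : ℝ :=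
  ‖z.2‖ ^ 2 / 2 + V z.proj + ∑ i, c i * W i z.proj

/-- `u` is piecewise constant on `[0, s]`: constant on every open subinterval that avoids some
fixed finite set. -/
def IsPiecewiseConstant {n : ℕ} (u : ℝ → Fin n → ℝ) (s : ℝ) : Prop :=
  ∃ F : Finset ℝ, ∀ a b : ℝ, Ioo a b ⊆ Icc 0 s \ (F : Set ℝ) →
    ∃ c : Fin n → ℝ, ∀ t ∈ Ioo a b, u t = c

/-- `z` is a solution on `[0, s]` of the classical system driven by the (piecewise constant)
control `u`: it is continuous on `[0, s]` and satisfies Hamilton's equations outside a finite set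
of times. -/
def IsClassicalSolution {n : ℕ} {M : Type*} [TopologicalSpace M]
    [ChartedSpace (EuclideanSpace ℝ (Fin n)) M] [IsManifold (𝓡 n) ∞ M]
    [RiemannianBundle (fun x : M => TangentSpace (𝓡 n) x)]
    (V : M → ℝ) (W : Fin n → M → ℝ) (u : ℝ → Fin n → ℝ) (s : ℝ)
    (z : ℝ → CotangentBundle n M) : Prop :=
  ContinuousOn z (Icc 0 s) ∧
    ∃ F : Finset ℝ, ∀ t ∈ Ioo 0 s \ (F : Set ℝ),
      HasMFDerivAt 𝓘(ℝ, ℝ) (cotangentModel n) z t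
        ((1 : ℝ →L[ℝ] ℝ).smulRight
          (hamiltonianVectorField (controlHamiltonian V W (u t)) (z t)))

/-- The set of states that can be reached from `z₀` in time at most `T` with piecewise constant
controls. -/
def classicalReachableSet {n : ℕ} {M : Type*} [TopologicalSpace M]
    [ChartedSpace (EuclideanSpace ℝ (Fin n)) M] [IsManifold (𝓡 n) ∞ M]
    [RiemannianBundle (fun x : M => TangentSpace (𝓡 n) x)]
    (V : M → ℝ) (W : Fin n → M → ℝ) (T : ℝ) (z₀ : CotangentBundle n M) :
    Set (CotangentBundle n M) :=
  {z₁ | ∃ s : ℝ, 0 ≤ s ∧ s ≤ T ∧ ∃ u : ℝ → Fin n → ℝ, IsPiecewiseConstant u s ∧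
    ∃ z : ℝ → CotangentBundle n M, IsClassicalSolution V W u s z ∧ z 0 = z₀ ∧ z s = z₁}

/-- The controllability diameter `T_c` of the classical system: the infimum, in `[0, ∞]`, of the
times `T ≥ 0` such that the states reachable in time at most `T` are dense in `T^*M` for all
initial states in some dense subset of `T^*M`. -/
noncomputable def classicalControllabilityDiameter {n : ℕ} {M : Type*} [TopologicalSpace M]
    [ChartedSpace (EuclideanSpace ℝ (Fin n)) M] [IsManifold (𝓡 n) ∞ M]
    [RiemannianBundle (fun x : M => TangentSpace (𝓡 n) x)]
    (V : M → ℝ) (W : Fin n → M → ℝ) : ℝ≥0∞ :=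
  sInf {τ : ℝ≥0∞ | ∃ T : ℝ≥0, τ = T ∧
    ∃ Υ : Set (CotangentBundle n M), Dense Υ ∧
      ∀ z₀ ∈ Υ, closure (classicalReachableSet V W T z₀) = univ}

/-- The system is small-time CA-controllable: `T_c = 0`. -/
def IsSmallTimeCAControllable {n : ℕ} {M : Type*} [TopologicalSpace M]
    [ChartedSpace (EuclideanSpace ℝ (Fin n)) M] [IsManifold (𝓡 n) ∞ M]
    [RiemannianBundle (fun x : M => TangentSpace (𝓡 n) x)]
    (V : M → ℝ) (W : Fin n → M → ℝ) : Prop :=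
  classicalControllabilityDiameter V W = 0

/-- The set `O` of points `x` at which `dW_1 ∧ ⋯ ∧ dW_n = 0` in the exterior power `⋀^n T_x^*M`. -/
def degeneracySet {n : ℕ} {M : Type*} [TopologicalSpace M]
    [ChartedSpace (EuclideanSpace ℝ (Fin n)) M] (W : Fin n → M → ℝ) : Set M :=
  {x | exteriorPower.ιMulti ℝ n (fun i => mvfderiv (𝓡 n) (W i) x) = 0}

/-!
The sufficiency of the condition on the degeneracy set `O` rests on two manoeuvres, each of which
can be made as short as desired.

* *Kicks* (`CotangentControl.steers_of_proj_eq`). Off `O` the differentials `dW_i` span `T_x^*M`, so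
  a constant control of size `1 / τ` acting during time `τ → 0` translates the covector by an
  arbitrary amount, while the base point does not move in the limit.
* *Fast geodesics* (`CotangentControl.exists_open_steers`). With control zero and a covector `R η`,
  `R → ∞`, the system follows during time `α / R` a reparametrised trajectory of a small
  perturbation of the geodesic flow. Since the latter is locally onto, any two nearby base points
  are joined exactly.

Both are statements about one family of fields, `CotangentControl.scaledField`, in canonical
coordinates: after `ξ = R η` and a change of time unit the trajectories live on the unit time
interval inside a fixed ball. The coordinate form of the system is obtained from the invariance of
the canonical symplectic form under changes of canonical coordinates
(`CotangentControl.exists_hasMFDerivAt_cotangentChart`) and from the expression of the dual metric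
in a chart (`CotangentControl.exists_hamilton_coord`). Completeness of the metric plays no role, as
all trajectories used stay in one chart.

Approximate reachability is not transitive, but the relation `CotangentControl.Steers`, which asks
for it uniformly near the initial state, is. Kick, geodesic and kick steer between any two states
over nearby points off `O`; as `O` has empty interior and `M` is connected, a clopen argument
(`CotangentControl.steers_of_notMem`) extends this to all states over the dense set of points off
`O`, in any positive time. Hence `T_c = 0`.

For `n = 1` an interior point of `O` has a neighbourhood on which `dW_1 = 0`. There the control
does not appear in Hamilton's equations, so the coordinate speed is bounded near a given state and
the states reachable in a short time from nearby states stay in a fixed closed box, which is not all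
of `T^*M` (`CotangentControl.not_isSmallTimeCAControllable`).
-/

namespace CotangentControl

/-! ### Flows of small vector fields on a ball -/

section Flow

variable {Z : Type*} [NormedAddCommGroup Z] [NormedSpace ℝ Z]

/-- `ζ` is a trajectory of the autonomous field `Φ` for the times `[0, 1]`, starting at `z` and
staying in the closed ball of radius `a` around `z₀`. -/
structure IsTrajectory (Φ : Z → Z) (z₀ : Z) (a : ℝ) (z : Z) (ζ : ℝ → Z) : Prop where
  init : ζ 0 = z
  mem : ∀ t ∈ Icc (0 : ℝ) 1, ζ t ∈ Metric.closedBall z₀ a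
  deriv : ∀ t ∈ Icc (0 : ℝ) 1, HasDerivWithinAt ζ (Φ (ζ t)) (Icc 0 1) t

/-- Picard–Lindelöf on a unit time interval: a Lipschitz field that is at most `a / 2` on a ball of
radius `a` has trajectories up to time `1` from every point of the ball of radius `a / 2`. -/
lemma exists_isTrajectory [CompleteSpace Z] {Φ : Z → Z} {z₀ : Z} {a : ℝ} (ha : 0 ≤ a)
    (hb : ∀ z ∈ Metric.closedBall z₀ a, ‖Φ z‖ ≤ a / 2) {K : ℝ≥0}
    (hl : LipschitzOnWith K Φ (Metric.closedBall z₀ a)) {z : Z}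
    (hz : z ∈ Metric.closedBall z₀ (a / 2)) :
    ∃ ζ : ℝ → Z, IsTrajectory Φ z₀ a z ζ := by
  lift a to ℝ≥0 using ha
  have hf : IsPicardLindelof (fun _ => Φ) (tmin := 0) (tmax := 1)
      ⟨0, by simp⟩ z₀ a (a / 2) (a / 2) K := by
    refine IsPicardLindelof.of_time_independent (by simpa using hb) hl ?_
    simp only [sub_zero, sub_self, zero_le_one, max_eq_left, mul_one, NNReal.coe_div,
      NNReal.coe_ofNat]
    linarith
  have hz' : z ∈ Metric.closedBall z₀ ((a / 2 : ℝ≥0) : ℝ) := by simpa using hz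
  obtain ⟨α, hα⟩ := ODE.FunSpace.exists_isFixedPt_next hf hz'
  refine ⟨α.compProj, ?_, fun t _ => α.compProj_mem_closedBall hf.mul_max_le, fun t ht => ?_⟩
  · have h0 : α.compProj ((⟨0, by simp⟩ : Icc (0 : ℝ) 1) : ℝ) = z := by
      rw [ODE.FunSpace.compProj_val, ← hα, ODE.FunSpace.next_apply₀]
    exact h0
  · apply ODE.hasDerivWithinAt_picard_Icc (t₀ := 0) (by simp) hf.continuousOn_uncurry
      α.continuous_compProj.continuousOn (fun _ ht' ↦ α.compProj_mem_closedBall hf.mul_max_le)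
      z ht |>.congr_of_mem _ ht
    intro t' ht'
    nth_rw 1 [← hα]
    rw [ODE.FunSpace.compProj_of_mem ht', ODE.FunSpace.next_apply]

variable {Φ : Z → Z} {z₀ : Z} {a : ℝ}

lemma IsTrajectory.continuousOn {z : Z} {ζ : ℝ → Z} (h : IsTrajectory Φ z₀ a z ζ) :
    ContinuousOn ζ (Icc 0 1) := fun t ht => (h.deriv t ht).continuousWithinAt

/-- Grönwall's inequality on the unit interval, with `exp 1 ≤ 3`. -/
lemma IsTrajectory.dist_le {K : ℝ≥0} (hK : K ≤ 1)
    (hl : LipschitzOnWith K Φ (Metric.closedBall z₀ a)) {z z' : Z} {ζ ζ' : ℝ → Z}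
    (h : IsTrajectory Φ z₀ a z ζ) (h' : IsTrajectory Φ z₀ a z' ζ') {t : ℝ}
    (ht : t ∈ Icc (0 : ℝ) 1) : ‖ζ t - ζ' t‖ ≤ 3 * ‖z - z'‖ := by
  have key := dist_le_of_trajectories_ODE_of_mem (v := fun _ => Φ) (K := K)
    (s := fun _ => Metric.closedBall z₀ a) (f := ζ) (g := ζ') (a := 0) (b := 1)
    (δ := dist z z') (fun _ _ => hl) h.continuousOn
    (fun t ht => (h.deriv t (Ico_subset_Icc_self ht)).mono_of_mem_nhdsWithin
      (Icc_mem_nhdsGE_of_mem ht)) (fun t ht => h.mem t (Ico_subset_Icc_self ht))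
    h'.continuousOn
    (fun t ht => (h'.deriv t (Ico_subset_Icc_self ht)).mono_of_mem_nhdsWithin
      (Icc_mem_nhdsGE_of_mem ht)) (fun t ht => h'.mem t (Ico_subset_Icc_self ht))
    (by rw [h.init, h'.init]) t ht
  rw [dist_eq_norm, dist_eq_norm, sub_zero] at key
  have h3 : Real.exp (K * t) ≤ 3 := by
    have hK' : (K : ℝ) ≤ 1 := by exact_mod_cast hK
    have : (K : ℝ) * t ≤ 1 := by nlinarith [ht.1, ht.2, K.2]
    exact (Real.exp_le_exp.2 this).trans (Real.exp_one_lt_d9.le.trans (by norm_num))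
  nlinarith [norm_nonneg (z - z')]

/-- Mean value inequality in the form used for comparison with a constant velocity. -/
lemma norm_sub_sub_smul_le {ζ d : ℝ → Z} {c : Z} {ε : ℝ} (hε : 0 ≤ ε)
    (hd : ∀ t ∈ Icc (0 : ℝ) 1, HasDerivWithinAt ζ (d t) (Icc 0 1) t)
    (hb : ∀ t ∈ Icc (0 : ℝ) 1, ‖d t - c‖ ≤ ε) {t : ℝ} (ht : t ∈ Icc (0 : ℝ) 1) :
    ‖ζ t - ζ 0 - t • c‖ ≤ ε := by
  have h1 : ∀ s ∈ Icc (0 : ℝ) 1,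
      HasDerivWithinAt (fun s => ζ s - s • c) (d s - c) (Icc 0 1) s := by
    intro s hs
    have := (hd s hs).sub ((hasDerivWithinAt_id s (Icc 0 1)).smul_const c)
    rwa [one_smul] at this
  have h2 := (convex_Icc (0 : ℝ) 1).norm_image_sub_le_of_norm_hasDerivWithin_le h1 hb
    (left_mem_Icc.2 zero_le_one) ht
  have h3 : ζ t - ζ 0 - t • c = ζ t - t • c - (ζ 0 - (0 : ℝ) • c) := by
    rw [zero_smul]; abel
  rw [h3]
  refine h2.trans ?_
  rw [sub_zero, Real.norm_of_nonneg ht.1]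
  nlinarith [ht.1, ht.2]

lemma IsTrajectory.norm_sub_init_le {z : Z} {ζ : ℝ → Z} (h : IsTrajectory Φ z₀ a z ζ) {L : ℝ}
    (hL : 0 ≤ L) (hb : ∀ z ∈ Metric.closedBall z₀ a, ‖Φ z‖ ≤ L) {t : ℝ}
    (ht : t ∈ Icc (0 : ℝ) 1) : ‖ζ t - z‖ ≤ L := by
  have := norm_sub_sub_smul_le (c := 0) hL h.deriv
    (fun t ht => by simpa using hb _ (h.mem t ht)) ht
  simpa [h.init] using this

end Flow

/-! ### Rescaled Hamiltonian fields -/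

section Scaled

variable {E P : Type*} [NormedAddCommGroup E] [NormedSpace ℝ E]
  [NormedAddCommGroup P] [NormedSpace ℝ P]

/-- The field `q̇ = α f(q, η)`, `η̇ = α k(q, η) + β v(q) + γ w(q)`. For a Hamiltonian
`½ ξ(G(q) ξ) + V(q) + W(q)` it is what Hamilton's equations become after `ξ = R η` and a change of
time unit: `f = G η`, `k` is the quadratic force, `v = -dV`, `w = -dW`. -/
def scaledField (f : E × P → E) (k : E × P → P) (v w : E → P) (α β γ : ℝ) (z : E × P) : E × P :=
  (α • f z, α • k z + β • v z.1 + γ • w z.1)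

/-- All the constituents of `scaledField` are bounded by `C` and `C`-Lipschitz on a ball. -/
structure FieldBounds (f : E × P → E) (k : E × P → P) (v w : E → P) (z₀ : E × P) (a : ℝ)
    (C : ℝ≥0) : Prop where
  bound_f : ∀ z ∈ Metric.closedBall z₀ a, ‖f z‖ ≤ C
  bound_k : ∀ z ∈ Metric.closedBall z₀ a, ‖k z‖ ≤ C
  bound_v : ∀ z ∈ Metric.closedBall z₀ a, ‖v z.1‖ ≤ C
  bound_w : ∀ z ∈ Metric.closedBall z₀ a, ‖w z.1‖ ≤ C
  lip_f : LipschitzOnWith C f (Metric.closedBall z₀ a)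
  lip_k : LipschitzOnWith C k (Metric.closedBall z₀ a)
  lip_v : LipschitzOnWith C (fun z : E × P => v z.1) (Metric.closedBall z₀ a)
  lip_w : LipschitzOnWith C (fun z : E × P => w z.1) (Metric.closedBall z₀ a)

variable {f : E × P → E} {k : E × P → P} {v w : E → P} {z₀ : E × P} {a : ℝ} {C : ℝ≥0}

omit [NormedSpace ℝ E] [NormedSpace ℝ P] in
lemma FieldBounds.mono (h : FieldBounds f k v w z₀ a C) {a' : ℝ} (ha : a' ≤ a) :
    FieldBounds f k v w z₀ a' C :=
  have hs := Metric.closedBall_subset_closedBall (x := z₀) ha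
  ⟨fun z hz => h.bound_f z (hs hz), fun z hz => h.bound_k z (hs hz),
    fun z hz => h.bound_v z (hs hz), fun z hz => h.bound_w z (hs hz),
    h.lip_f.mono hs, h.lip_k.mono hs, h.lip_v.mono hs, h.lip_w.mono hs⟩

lemma exists_bound_lipschitz {X Y : Type*} [NormedAddCommGroup X] [NormedSpace ℝ X]
    [NormedAddCommGroup Y] [NormedSpace ℝ Y] {F : X → Y} {x₀ : X} (hF : ContDiffAt ℝ 1 F x₀) :
    ∃ C : ℝ≥0, ∃ a > 0, (∀ x ∈ Metric.closedBall x₀ a, ‖F x‖ ≤ C) ∧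
      LipschitzOnWith C F (Metric.closedBall x₀ a) := by
  obtain ⟨K, t, ht, hK⟩ := hF.exists_lipschitzOnWith
  obtain ⟨r, hr, hrt⟩ := Metric.nhds_basis_closedBall.mem_iff.1 ht
  refine ⟨K + K * ⟨r, hr.le⟩ + ‖F x₀‖₊, r, hr, fun x hx => ?_, (hK.mono hrt).weaken ?_⟩
  · have h1 := hK.norm_sub_le (hrt hx) (hrt (Metric.mem_closedBall_self hr.le))
    have h2 : ‖F x‖ ≤ ‖F x - F x₀‖ + ‖F x₀‖ := by
      simpa using norm_add_le (F x - F x₀) (F x₀)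
    have h3 : ‖x - x₀‖ ≤ r := mem_closedBall_iff_norm.1 hx
    push_cast
    have : (K : ℝ) * ‖x - x₀‖ ≤ K * r := by gcongr
    change _ ≤ (K : ℝ) + K * r + ‖F x₀‖
    linarith [K.2]
  · rw [add_assoc]; exact le_self_add

lemma exists_fieldBounds {q₀ : E} {p₀ : P} (hf : ContDiffAt ℝ 1 f (q₀, p₀))
    (hk : ContDiffAt ℝ 1 k (q₀, p₀)) (hv : ContDiffAt ℝ 1 v q₀) (hw : ContDiffAt ℝ 1 w q₀) :
    ∃ C : ℝ≥0, ∃ a > 0, FieldBounds f k v w (q₀, p₀) a C := by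
  have hv' : ContDiffAt ℝ 1 (fun z : E × P => v z.1) (q₀, p₀) :=
    ContDiffAt.comp (q₀, p₀) (g := v) hv contDiffAt_fst
  have hw' : ContDiffAt ℝ 1 (fun z : E × P => w z.1) (q₀, p₀) :=
    ContDiffAt.comp (q₀, p₀) (g := w) hw contDiffAt_fst
  obtain ⟨C, a, ha, hb, hl⟩ := exists_bound_lipschitz ((hf.prodMk hk).prodMk (hv'.prodMk hw'))
  refine ⟨C, a, ha, fun z hz => ?_, fun z hz => ?_, fun z hz => ?_, fun z hz => ?_, ?_, ?_, ?_, ?_⟩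
  · exact (norm_fst_le (f z, k z)).trans
      ((norm_fst_le ((f z, k z), (v z.1, w z.1))).trans (hb z hz))
  · exact (norm_snd_le (f z, k z)).trans
      ((norm_fst_le ((f z, k z), (v z.1, w z.1))).trans (hb z hz))
  · exact (norm_fst_le (v z.1, w z.1)).trans
      ((norm_snd_le ((f z, k z), (v z.1, w z.1))).trans (hb z hz))
  · exact (norm_snd_le (v z.1, w z.1)).trans
      ((norm_snd_le ((f z, k z), (v z.1, w z.1))).trans (hb z hz))
  · exact ((LipschitzWith.prod_fst.comp LipschitzWith.prod_fst).comp_lipschitzOnWith hl).weaken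
      (by simp)
  · exact ((LipschitzWith.prod_snd.comp LipschitzWith.prod_fst).comp_lipschitzOnWith hl).weaken
      (by simp)
  · exact ((LipschitzWith.prod_fst.comp LipschitzWith.prod_snd).comp_lipschitzOnWith hl).weaken
      (by simp)
  · exact ((LipschitzWith.prod_snd.comp LipschitzWith.prod_snd).comp_lipschitzOnWith hl).weaken
      (by simp)

variable {α β γ : ℝ}

lemma FieldBounds.norm_scaledField_le (h : FieldBounds f k v w z₀ a C) (hα : 0 ≤ α) (hβ : 0 ≤ β)
    (hγ : 0 ≤ γ) {z : E × P} (hz : z ∈ Metric.closedBall z₀ a) :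
    ‖scaledField f k v w α β γ z‖ ≤ (α + β + γ) * C := by
  have h1 : ‖α • f z‖ ≤ α * C := by
    rw [norm_smul, Real.norm_of_nonneg hα]; gcongr; exact h.bound_f z hz
  have h2 : ‖α • k z‖ ≤ α * C := by
    rw [norm_smul, Real.norm_of_nonneg hα]; gcongr; exact h.bound_k z hz
  have h3 : ‖β • v z.1‖ ≤ β * C := by
    rw [norm_smul, Real.norm_of_nonneg hβ]; gcongr; exact h.bound_v z hz
  have h4 : ‖γ • w z.1‖ ≤ γ * C := by
    rw [norm_smul, Real.norm_of_nonneg hγ]; gcongr; exact h.bound_w z hz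
  have h5 : 0 ≤ β * C := by positivity
  have h6 : 0 ≤ γ * C := by positivity
  refine norm_prod_le_iff.2 ⟨?_, ?_⟩
  · change ‖α • f z‖ ≤ _; linarith
  · change ‖α • k z + β • v z.1 + γ • w z.1‖ ≤ _
    linarith [norm_add₃_le (a := α • k z) (b := β • v z.1) (c := γ • w z.1)]

lemma FieldBounds.lipschitzOnWith_scaledField (h : FieldBounds f k v w z₀ a C) (hα : 0 ≤ α)
    (hβ : 0 ≤ β) (hγ : 0 ≤ γ) :
    LipschitzOnWith (Real.toNNReal (α + β + γ) * C) (scaledField f k v w α β γ)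
      (Metric.closedBall z₀ a) := by
  refine LipschitzOnWith.of_dist_le_mul fun x hx y hy => ?_
  have hf := h.lip_f.norm_sub_le hx hy
  have hk := h.lip_k.norm_sub_le hx hy
  have hv := h.lip_v.norm_sub_le hx hy
  have hw := h.lip_w.norm_sub_le hx hy
  have h1 : ‖α • (f x - f y)‖ ≤ α * (C * ‖x - y‖) := by
    rw [norm_smul, Real.norm_of_nonneg hα]; gcongr
  have h2 : ‖α • (k x - k y)‖ ≤ α * (C * ‖x - y‖) := by
    rw [norm_smul, Real.norm_of_nonneg hα]; gcongr
  have h3 : ‖β • (v x.1 - v y.1)‖ ≤ β * (C * ‖x - y‖) := by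
    rw [norm_smul, Real.norm_of_nonneg hβ]; gcongr
  have h4 : ‖γ • (w x.1 - w y.1)‖ ≤ γ * (C * ‖x - y‖) := by
    rw [norm_smul, Real.norm_of_nonneg hγ]; gcongr
  have h5 : 0 ≤ β * (C * ‖x - y‖) := by positivity
  have h6 : 0 ≤ γ * (C * ‖x - y‖) := by positivity
  rw [dist_eq_norm, dist_eq_norm]
  push_cast
  rw [Real.coe_toNNReal _ (by positivity)]
  have e : scaledField f k v w α β γ x - scaledField f k v w α β γ y =
      (α • (f x - f y), α • (k x - k y) + β • (v x.1 - v y.1) + γ • (w x.1 - w y.1)) := by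
    ext1
    · simp only [scaledField, Prod.fst_sub, smul_sub]
    · simp only [scaledField, Prod.snd_sub, smul_sub]; abel
  rw [e]
  refine norm_prod_le_iff.2 ⟨?_, ?_⟩
  · dsimp only; linarith
  · dsimp only
    linarith [norm_add₃_le (a := α • (k x - k y)) (b := β • (v x.1 - v y.1))
      (c := γ • (w x.1 - w y.1))]

lemma FieldBounds.exists_isTrajectory [CompleteSpace E] [CompleteSpace P]
    (h : FieldBounds f k v w z₀ a C) (ha : 0 ≤ a) (hα : 0 ≤ α) (hβ : 0 ≤ β)
    (hγ : 0 ≤ γ) (hs : (α + β + γ) * C ≤ a / 2) {z : E × P}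
    (hz : z ∈ Metric.closedBall z₀ (a / 2)) :
    ∃ ζ : ℝ → E × P, IsTrajectory (scaledField f k v w α β γ) z₀ a z ζ :=
  CotangentControl.exists_isTrajectory ha
    (fun _ hz => (h.norm_scaledField_le hα hβ hγ hz).trans hs)
    (h.lipschitzOnWith_scaledField hα hβ hγ) hz

lemma FieldBounds.dist_trajectory_le (h : FieldBounds f k v w z₀ a C) (hα : 0 ≤ α)
    (hβ : 0 ≤ β) (hγ : 0 ≤ γ) (hs : (α + β + γ) * C ≤ 1) {z z' : E × P} {ζ ζ' : ℝ → E × P}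
    (hζ : IsTrajectory (scaledField f k v w α β γ) z₀ a z ζ)
    (hζ' : IsTrajectory (scaledField f k v w α β γ) z₀ a z' ζ') {t : ℝ}
    (ht : t ∈ Icc (0 : ℝ) 1) : ‖ζ t - ζ' t‖ ≤ 3 * ‖z - z'‖ := by
  refine hζ.dist_le ?_ (h.lipschitzOnWith_scaledField hα hβ hγ) hζ' ht
  rw [← NNReal.coe_le_coe]
  push_cast
  rwa [Real.coe_toNNReal _ (by positivity)]

lemma hasDerivWithinAt_fst {ζ : ℝ → E × P} {d : E × P} {s : Set ℝ} {t : ℝ}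
    (h : HasDerivWithinAt ζ d s t) : HasDerivWithinAt (fun t => (ζ t).1) d.1 s t :=
  (hasFDerivAt_fst (𝕜 := ℝ) (p := ζ t)).comp_hasDerivWithinAt t h

lemma hasDerivWithinAt_snd {ζ : ℝ → E × P} {d : E × P} {s : Set ℝ} {t : ℝ}
    (h : HasDerivWithinAt ζ d s t) : HasDerivWithinAt (fun t => (ζ t).2) d.2 s t :=
  (hasFDerivAt_snd (𝕜 := ℝ) (p := ζ t)).comp_hasDerivWithinAt t h

/-- When `α` and `β` are small, a trajectory of `scaledField` barely moves in `q`, while `η` is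
translated by nearly `γ w(q₀)`. -/
lemma FieldBounds.dist_kick_le (h : FieldBounds f k v w z₀ a C) (hα : 0 ≤ α)
    (hβ : 0 ≤ β) (hγ : 0 ≤ γ) {z : E × P} {ζ : ℝ → E × P} (η₀ : P) (ha : 0 ≤ a)
    (hζ : IsTrajectory (scaledField f k v w α β γ) z₀ a z ζ) :
    ‖ζ 1 - (z₀.1, η₀ + γ • w z₀.1)‖ ≤
      ‖z - (z₀.1, η₀)‖ + (α + β) * C + γ * (C * (‖z - (z₀.1, η₀)‖ + α * C)) := by
  set D := ‖z - (z₀.1, η₀)‖ with hD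
  have hD1 : ‖z.1 - z₀.1‖ ≤ D := norm_fst_le (z - (z₀.1, η₀))
  have hD2 : ‖z.2 - η₀‖ ≤ D := norm_snd_le (z - (z₀.1, η₀))
  have h1t : ∀ t ∈ Icc (0 : ℝ) 1, ‖(ζ t).1 - z.1‖ ≤ α * C := by
    intro t ht
    have := norm_sub_sub_smul_le (c := 0) (ε := α * C) (by positivity)
      (fun t ht => hasDerivWithinAt_fst (hζ.deriv t ht)) (fun t ht => ?_) ht
    · simpa [hζ.init] using this
    · simp only [scaledField, sub_zero]
      rw [norm_smul, Real.norm_of_nonneg hα]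
      gcongr
      exact h.bound_f _ (hζ.mem t ht)
  have hwt : ∀ t ∈ Icc (0 : ℝ) 1, ‖w (ζ t).1 - w z₀.1‖ ≤ C * (D + α * C) := by
    intro t ht
    have hm : ((ζ t).1, z₀.2) ∈ Metric.closedBall z₀ a := by
      have := hζ.mem t ht
      rw [mem_closedBall_iff_norm] at this ⊢
      refine norm_prod_le_iff.2 ⟨(norm_fst_le (ζ t - z₀)).trans this, by simpa using ha⟩
    have h1 := h.lip_w.norm_sub_le hm (Metric.mem_closedBall_self ha)
    refine h1.trans ?_
    gcongr
    refine norm_prod_le_iff.2 ⟨?_, by simp; positivity⟩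
    have : (ζ t).1 - z₀.1 = ((ζ t).1 - z.1) + (z.1 - z₀.1) := by abel
    change ‖(ζ t).1 - z₀.1‖ ≤ _
    rw [this]
    linarith [norm_add_le ((ζ t).1 - z.1) (z.1 - z₀.1), h1t t ht]
  have h2 : ‖(ζ 1).2 - (ζ 0).2 - (1 : ℝ) • (γ • w z₀.1)‖ ≤
      (α + β) * C + γ * (C * (D + α * C)) := by
    refine norm_sub_sub_smul_le (by positivity)
      (fun t ht => hasDerivWithinAt_snd (hζ.deriv t ht)) (fun t ht => ?_)
      (right_mem_Icc.2 zero_le_one)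
    have e : (scaledField f k v w α β γ (ζ t)).2 - γ • w z₀.1 =
        α • k (ζ t) + β • v (ζ t).1 + γ • (w (ζ t).1 - w z₀.1) := by
      simp only [scaledField, smul_sub]; abel
    rw [e]
    have g2 : ‖α • k (ζ t)‖ ≤ α * C := by
      rw [norm_smul, Real.norm_of_nonneg hα]; gcongr; exact h.bound_k _ (hζ.mem t ht)
    have g3 : ‖β • v (ζ t).1‖ ≤ β * C := by
      rw [norm_smul, Real.norm_of_nonneg hβ]; gcongr; exact h.bound_v _ (hζ.mem t ht)
    have g4 : ‖γ • (w (ζ t).1 - w z₀.1)‖ ≤ γ * (C * (D + α * C)) := by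
      rw [norm_smul, Real.norm_of_nonneg hγ]; gcongr; exact hwt t ht
    linarith [norm_add₃_le (a := α • k (ζ t)) (b := β • v (ζ t).1)
      (c := γ • (w (ζ t).1 - w z₀.1))]
  have h0 : 0 ≤ β * C := by positivity
  have h0' : 0 ≤ γ * (C * (D + α * C)) := by positivity
  refine norm_prod_le_iff.2 ⟨?_, ?_⟩
  · change ‖(ζ 1).1 - z₀.1‖ ≤ _
    have : (ζ 1).1 - z₀.1 = ((ζ 1).1 - z.1) + (z.1 - z₀.1) := by abel
    rw [this]
    linarith [norm_add_le ((ζ 1).1 - z.1) (z.1 - z₀.1), h1t 1 (right_mem_Icc.2 zero_le_one)]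
  · change ‖(ζ 1).2 - (η₀ + γ • w z₀.1)‖ ≤ _
    have : (ζ 1).2 - (η₀ + γ • w z₀.1) =
        ((ζ 1).2 - (ζ 0).2 - (1 : ℝ) • (γ • w z₀.1)) + (z.2 - η₀) := by
      rw [hζ.init, one_smul]; abel
    rw [this]
    linarith [norm_add_le ((ζ 1).2 - (ζ 0).2 - (1 : ℝ) • (γ • w z₀.1)) (z.2 - η₀)]

/-- Local surjectivity of the exponential map, uniformly in the perturbation `β v`: for a suitable
fixed `α`, any two points near `q₀` are joined, in unit time, by a trajectory of
`scaledField f k v w α β 0` with a small initial `η`. For small `α` the map `η ↦ α⁻¹ q(1)` is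
Lipschitz-close to the invertible map `A`, the velocity being `α f(q, η) ≈ α A η`. -/
lemma exists_trajectory_hits [CompleteSpace E] [CompleteSpace P] {q₀ : E}
    (h : FieldBounds f k v w (q₀, (0 : P)) a C) (ha : 0 < a)
    {A : P ≃L[ℝ] E}
    (hA : HasStrictFDerivAt f ((A : P →L[ℝ] E) ∘L ContinuousLinearMap.snd ℝ E P) (q₀, (0 : P)))
    (h0 : ∀ q, f (q, 0) = 0) :
    ∃ a' > 0, a' ≤ a ∧ ∃ α > 0, ∃ ε > 0, (α + α + 0) * C ≤ a' / 2 ∧ (α + α + 0) * C ≤ 1 ∧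
      ∀ β, 0 ≤ β → β ≤ α → ∀ q ∈ Metric.closedBall q₀ ε, ∀ y ∈ Metric.closedBall q₀ ε,
        (∀ η ∈ Metric.closedBall (0 : P) (a' / 4),
          (q, η) ∈ Metric.closedBall (q₀, (0 : P)) (a' / 4)) ∧
        ∃ η ∈ Metric.closedBall (0 : P) (a' / 4), ∃ ζ : ℝ → E × P,
          IsTrajectory (scaledField f k v w α β 0) (q₀, 0) a' (q, η) ζ ∧ (ζ 1).1 = y := by
  set N : ℝ≥0 := ‖(A.symm : E →L[ℝ] P)‖₊ + 1 with hN
  have hN0 : 0 < N := by positivity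
  set c : ℝ≥0 := N⁻¹ / 2 with hc
  have hc0 : 0 < c := by positivity
  let S : (A : P →L[ℝ] E).NonlinearRightInverse :=
    { toFun := A.symm
      nnnorm := N
      bound' := fun y => by
        refine ((A.symm : E →L[ℝ] P).le_opNorm y).trans ?_
        gcongr
        rw [hN]; push_cast; simp
      right_inv' := fun y => by simp }
  obtain ⟨t, ht, happ⟩ := hA.approximates_deriv_on_nhds (c := c / 8) (Or.inr (by positivity))
  obtain ⟨r₀, hr₀, hr₀t⟩ := Metric.nhds_basis_closedBall.mem_iff.1 ht
  set a' := min a r₀ with ha'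
  have ha'0 : 0 < a' := lt_min ha hr₀
  have ha'a : a' ≤ a := min_le_left _ _
  have happ' : ApproximatesLinearOn f ((A : P →L[ℝ] E) ∘L ContinuousLinearMap.snd ℝ E P)
      (Metric.closedBall (q₀, (0 : P)) a') (c / 8) :=
    happ.mono_set ((Metric.closedBall_subset_closedBall (min_le_right _ _)).trans hr₀t)
  have hB := h.mono ha'a
  set r : ℝ := c * (a' / 4) with hr
  have hr0 : 0 < r := by positivity
  set m : ℝ := min (min (a' / 2) 1) (min (c / (6 * (‖(A : P →L[ℝ] E)‖ + 1)))
    (r / (2 * ((C : ℝ) + 1)))) with hm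
  have hm0 : 0 < m := by positivity
  -- `α` is chosen so that `2 α C ≤ m`, which makes all the error terms small
  set α : ℝ := m / (2 * ((C : ℝ) + 1)) with hαd
  have hα0 : 0 < α := by positivity
  have hαm : (α + α) * C ≤ m := by
    have h1 : (α + α) * ((C : ℝ) + 1) = m := by rw [hαd]; field_simp; ring
    nlinarith
  have hm1 : m ≤ a' / 2 := (min_le_left _ _).trans (min_le_left _ _)
  have hm2 : m ≤ 1 := (min_le_left _ _).trans (min_le_right _ _)
  have hm3 : ‖(A : P →L[ℝ] E)‖ * (3 * m) ≤ c / 2 := by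
    have h1 : m ≤ c / (6 * (‖(A : P →L[ℝ] E)‖ + 1)) := (min_le_right _ _).trans (min_le_left _ _)
    rw [le_div_iff₀ (by positivity)] at h1
    linarith
  have hm4 : C * m ≤ r / 2 := by
    have h1 : m ≤ r / (2 * ((C : ℝ) + 1)) := (min_le_right _ _).trans (min_le_right _ _)
    rw [le_div_iff₀ (by positivity)] at h1
    linarith
  refine ⟨a', ha'0, ha'a, α, hα0, min (α * r / 4) (a' / 4), by positivity, ?_, ?_, ?_⟩
  · linarith
  · linarith
  intro β hβ0 hβα q hq y hy
  have hβm : (α + β + 0) * C ≤ m := by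
    have : (α + β + 0) * (C : ℝ) ≤ (α + α) * C := by gcongr ?_ * _; linarith
    linarith
  have hmem : ∀ η ∈ Metric.closedBall (0 : P) (a' / 4),
      (q, η) ∈ Metric.closedBall (q₀, (0 : P)) (a' / 4) := by
    intro η hη
    rw [← closedBall_prod_same]
    exact ⟨Metric.closedBall_subset_closedBall (min_le_right _ _) hq, hη⟩
  refine ⟨hmem, ?_⟩
  have hex : ∀ η, ∃ ζ : ℝ → E × P, η ∈ Metric.closedBall (0 : P) (a' / 4) →
      IsTrajectory (scaledField f k v w α β 0) (q₀, 0) a' (q, η) ζ := by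
    intro η
    by_cases hη : η ∈ Metric.closedBall (0 : P) (a' / 4)
    · obtain ⟨ζ, hζ⟩ := hB.exists_isTrajectory ha'0.le hα0.le hβ0 le_rfl (hβm.trans hm1)
        (Metric.closedBall_subset_closedBall (by linarith) (hmem η hη))
      exact ⟨ζ, fun _ => hζ⟩
    · exact ⟨fun _ => 0, fun h => absurd h hη⟩
  choose Θ hΘ using hex
  have happrox : ApproximatesLinearOn (fun η => α⁻¹ • (Θ η 1).1) (A : P →L[ℝ] E)
      (Metric.closedBall (0 : P) (a' / 4)) c := by
    intro η hη η' hη'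
    set D := ‖η - η'‖ with hD
    have hdist : ∀ t ∈ Icc (0 : ℝ) 1, ‖Θ η t - Θ η' t‖ ≤ 3 * D := by
      intro t ht
      refine (hB.dist_trajectory_le hα0.le hβ0 le_rfl (hβm.trans hm2) (hΘ η hη) (hΘ η' hη')
        ht).trans (le_of_eq ?_)
      simp [hD, Prod.norm_def]
    have hsnd : ∀ t ∈ Icc (0 : ℝ) 1, ‖(Θ η t).2 - (Θ η' t).2 - (η - η')‖ ≤ m * (3 * D) := by
      intro t ht
      have := norm_sub_sub_smul_le (ζ := fun t => (Θ η t).2 - (Θ η' t).2) (c := 0)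
        (ε := m * (3 * D)) (by positivity)
        (fun t ht => (hasDerivWithinAt_snd ((hΘ η hη).deriv t ht)).sub
          (hasDerivWithinAt_snd ((hΘ η' hη').deriv t ht))) (fun t ht => ?_) ht
      · simpa [(hΘ η hη).init, (hΘ η' hη').init] using this
      · rw [sub_zero]
        refine (norm_snd_le (scaledField f k v w α β 0 (Θ η t) -
          scaledField f k v w α β 0 (Θ η' t))).trans ?_
        refine ((hB.lipschitzOnWith_scaledField hα0.le hβ0 le_rfl).norm_sub_le
          ((hΘ η hη).mem t ht) ((hΘ η' hη').mem t ht)).trans ?_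
        push_cast
        rw [Real.coe_toNNReal _ (by positivity)]
        exact mul_le_mul hβm (hdist t ht) (norm_nonneg _) hm0.le
    have hvel : ∀ t ∈ Icc (0 : ℝ) 1,
        ‖f (Θ η t) - f (Θ η' t) - (A : P →L[ℝ] E) (η - η')‖ ≤ c * D := by
      intro t ht
      have h1 := happ' _ ((hΘ η hη).mem t ht) _ ((hΘ η' hη').mem t ht)
      have h2 := (A : P →L[ℝ] E).le_opNorm ((Θ η t).2 - (Θ η' t).2 - (η - η'))
      have e : f (Θ η t) - f (Θ η' t) - (A : P →L[ℝ] E) (η - η') =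
          (f (Θ η t) - f (Θ η' t) -
            ((A : P →L[ℝ] E) ∘L ContinuousLinearMap.snd ℝ E P) (Θ η t - Θ η' t)) +
          (A : P →L[ℝ] E) ((Θ η t).2 - (Θ η' t).2 - (η - η')) := by
        simp only [ContinuousLinearMap.comp_apply, ContinuousLinearMap.coe_snd',
          map_sub]
        abel
      rw [e]
      have h3 : ((c / 8 : ℝ≥0) : ℝ) * ‖Θ η t - Θ η' t‖ ≤ c / 8 * (3 * D) := by
        push_cast
        have := hdist t ht
        gcongr
      have h4 : ‖(A : P →L[ℝ] E)‖ * ‖(Θ η t).2 - (Θ η' t).2 - (η - η')‖ ≤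
          ‖(A : P →L[ℝ] E)‖ * (m * (3 * D)) := by
        have := hsnd t ht
        gcongr
      have h5 : ‖(A : P →L[ℝ] E)‖ * (m * (3 * D)) ≤ c / 2 * D := by
        have : ‖(A : P →L[ℝ] E)‖ * (m * (3 * D)) = ‖(A : P →L[ℝ] E)‖ * (3 * m) * D := by ring
        rw [this]
        gcongr
      have h6 : 0 ≤ (c : ℝ) * D := by positivity
      refine (norm_add_le _ _).trans ?_
      linarith
    have := norm_sub_sub_smul_le (ζ := fun t => α⁻¹ • (Θ η t).1 - α⁻¹ • (Θ η' t).1)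
        (c := (A : P →L[ℝ] E) (η - η')) (ε := c * D) (by positivity)
        (fun t ht => ((hasDerivWithinAt_fst ((hΘ η hη).deriv t ht)).const_smul α⁻¹).sub
          ((hasDerivWithinAt_fst ((hΘ η' hη').deriv t ht)).const_smul α⁻¹)) (fun t ht => ?_)
        (right_mem_Icc.2 zero_le_one)
    · simpa [(hΘ η hη).init, (hΘ η' hη').init] using this
    · simp only [scaledField, inv_smul_smul₀ hα0.ne']
      exact hvel t ht
  have hzero : (0 : P) ∈ Metric.closedBall (0 : P) (a' / 4) :=
    Metric.mem_closedBall_self (by positivity)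
  have hq1 : ‖(Θ 0 1).1 - q‖ ≤ α * (r / 2) := by
    have hΘ0 := hΘ 0 hzero
    have := norm_sub_sub_smul_le (c := 0) (ε := α * (r / 2)) (by positivity)
      (fun t ht => hasDerivWithinAt_fst (hΘ0.deriv t ht)) (fun t ht => ?_)
      (right_mem_Icc.2 zero_le_one)
    · simpa [hΘ0.init] using this
    · simp only [scaledField, sub_zero]
      rw [norm_smul, Real.norm_of_nonneg hα0.le]
      gcongr
      have h1 := hB.lip_f.norm_sub_le (hΘ0.mem t ht)
        (Metric.closedBall_subset_closedBall (by linarith) (hmem 0 hzero))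
      rw [h0 q, sub_zero] at h1
      have h2 := hΘ0.norm_sub_init_le hm0.le
        (fun z hz => (hB.norm_scaledField_le hα0.le hβ0 le_rfl hz).trans hβm) ht
      have h3 : (C : ℝ) * ‖Θ 0 t - (q, 0)‖ ≤ C * m := by gcongr
      linarith
  have hsurj := happrox.surjOn_closedBall_of_nonlinearRightInverse S
    (ε := a' / 4) (b := 0) (by positivity) subset_rfl
  have hrad : ((S.nnnorm : ℝ)⁻¹ - c) * (a' / 4) = r := by
    change ((N : ℝ)⁻¹ - c) * (a' / 4) = r
    rw [hr, hc]; push_cast; ring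
  rw [hrad] at hsurj
  have hy' : α⁻¹ • y ∈ Metric.closedBall (α⁻¹ • (Θ 0 1).1) r := by
    rw [mem_closedBall_iff_norm, ← smul_sub, norm_smul, norm_inv, Real.norm_of_nonneg hα0.le,
      inv_mul_le_iff₀ hα0]
    have hq' : ‖q - q₀‖ ≤ α * r / 4 := (mem_closedBall_iff_norm.1 hq).trans (min_le_left _ _)
    have hy'' : ‖y - q₀‖ ≤ α * r / 4 := (mem_closedBall_iff_norm.1 hy).trans (min_le_left _ _)
    have e : y - (Θ 0 1).1 = (y - q₀) - (q - q₀) - ((Θ 0 1).1 - q) := by abel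
    rw [e]
    linarith [norm_sub_le ((y - q₀) - (q - q₀)) ((Θ 0 1).1 - q), norm_sub_le (y - q₀) (q - q₀)]
  obtain ⟨η, hη, hηy⟩ := hsurj hy'
  exact ⟨η, hη, Θ η, hΘ η hη, (smul_right_injective E (inv_ne_zero hα0.ne')) hηy⟩

end Scaled

/-- The model space of the base manifold. -/
abbrev Model (n : ℕ) : Type := EuclideanSpace ℝ (Fin n)
/-- The model space of the fibres of the cotangent bundle. -/
abbrev Covector (n : ℕ) : Type := Model n →L[ℝ] ℝ
/-- The model space of the cotangent bundle, with points `(q, ξ)`. -/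
abbrev Phase (n : ℕ) : Type := Model n × Covector n

/-! ### Hamiltonian vectors and canonical coordinates -/

section Symplectic
variable {n : ℕ}

lemma finrank_covector : Module.finrank ℝ (Covector n) = n := by
  rw [← (LinearMap.toContinuousLinearMap (𝕜 := ℝ) (E := Model n) (F' := ℝ)).finrank_eq]
  exact (Subspace.dual_finrank_eq (K := ℝ) (V := Model n)).trans finrank_euclideanSpace_fin

/-- The Hamiltonian vector `(∂L/∂ξ, -∂L/∂q)` of a linear form `L` on the phase space. It is
characterised by `L v = ω(X, v)` for the canonical symplectic form
`ω((a, α), (b, β)) = β a - α b`. -/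
noncomputable def hamiltonianVector (L : Phase n →L[ℝ] ℝ) : Phase n :=
  (WithLp.toLp 2 fun i => L (0, EuclideanSpace.proj i), -(L.comp (ContinuousLinearMap.inl ℝ _ _)))

lemma apply_eq_hamiltonianVector (L : Phase n →L[ℝ] ℝ) (v : Phase n) :
    L v = v.2 (hamiltonianVector L).1 - (hamiltonianVector L).2 v.1 := by
  have h1 : v = (v.1, 0) + (0, v.2) := by simp
  have h2 : v.2 = ∑ i, v.2 (EuclideanSpace.single i 1) • (EuclideanSpace.proj i : Covector n) := by
    ext x
    have := (EuclideanSpace.basisFun (Fin n) ℝ).sum_repr x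
    conv_lhs => rw [← this]
    simp [mul_comm]
  have h3 : L (0, v.2) = v.2 (hamiltonianVector L).1 := by
    have e : ∀ μ : Covector n, L (0, μ) = (L ∘L ContinuousLinearMap.inr ℝ _ _) μ := fun _ => rfl
    rw [e]
    conv_lhs => rw [h2]
    conv_rhs => rw [h2]
    simp [hamiltonianVector]
  conv_lhs => rw [h1, map_add, h3]
  simp [hamiltonianVector]
  ring

lemma eq_hamiltonianVector {L : Phase n →L[ℝ] ℝ} {X : Phase n}
    (h : ∀ v : Phase n, L v = v.2 X.1 - X.2 v.1) : X = hamiltonianVector L := by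
  ext1
  · ext i
    have := h (0, EuclideanSpace.proj i)
    simp at this
    simp [hamiltonianVector, this]
  · ext x
    have := h (x, 0)
    simp at this
    simp [hamiltonianVector, this]

end Symplectic

variable {n : ℕ} {M : Type*} [TopologicalSpace M] [ChartedSpace (EuclideanSpace ℝ (Fin n)) M]
  [IsManifold (𝓡 n) ∞ M]

/-- The canonical coordinates `(q, ξ)` on `T^*M` induced by the chart of `M` at `x₀`. The chart of
`T^*M` at a point over `x₀` does not depend on the covector, which is therefore taken to be `0`. -/
noncomputable def cotangentChart (x₀ : M) : PartialEquiv (CotangentBundle n M) (Phase n) :=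
  extChartAt (cotangentModel n) (⟨x₀, 0⟩ : CotangentBundle n M)

lemma extChartAt_cotangent (z : CotangentBundle n M) :
    extChartAt (cotangentModel n) z = cotangentChart z.proj := by
  rw [cotangentChart, FiberBundle.extChartAt, FiberBundle.extChartAt]

lemma mem_cotangentChart_source {x₀ : M} {z : CotangentBundle n M} :
    z ∈ (cotangentChart (n := n) x₀).source ↔ z.proj ∈ (extChartAt (𝓡 n) x₀).source := by
  rw [cotangentChart, FiberBundle.extChartAt]
  simp only [mfld_simps]
  exact ⟨fun h => h.1.1, fun h => ⟨⟨h, mem_univ _⟩, h⟩⟩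

lemma cotangentChart_target (x₀ : M) :
    (cotangentChart (n := n) x₀).target = (extChartAt (𝓡 n) x₀).target ×ˢ univ := by
  rw [cotangentChart, FiberBundle.extChartAt_target]
  congr 1
  ext q
  simp
  intro h'
  simpa using (chartAt (EuclideanSpace ℝ (Fin n)) x₀).map_target h'

lemma cotangentChart_apply (x₀ : M) (z : CotangentBundle n M) :
    cotangentChart x₀ z = (extChartAt (𝓡 n) x₀ z.proj,
      z.2 ∘L ((trivializationAt (Model n) (TangentSpace (𝓡 n)) x₀).symmL ℝ z.proj)) := by
  rw [cotangentChart, FiberBundle.extChartAt]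
  simp [hom_trivializationAt_apply, ContinuousLinearMap.inCoordinates]

lemma cotangentChart_symm_apply {x₀ : M} {q : Model n} (hq : q ∈ (extChartAt (𝓡 n) x₀).target)
    (ξ : Covector n) :
    (cotangentChart x₀).symm (q, ξ) = (⟨(extChartAt (𝓡 n) x₀).symm q,
      ξ ∘L ((trivializationAt (Model n) (TangentSpace (𝓡 n)) x₀).continuousLinearMapAt ℝ
        ((extChartAt (𝓡 n) x₀).symm q))⟩ : CotangentBundle n M) := by
  set z : CotangentBundle n M := ⟨(extChartAt (𝓡 n) x₀).symm q,
      ξ ∘L ((trivializationAt (Model n) (TangentSpace (𝓡 n)) x₀).continuousLinearMapAt ℝ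
        ((extChartAt (𝓡 n) x₀).symm q))⟩ with hz
  have hsrc : (extChartAt (𝓡 n) x₀).symm q ∈ (extChartAt (𝓡 n) x₀).source :=
    (extChartAt (𝓡 n) x₀).map_target hq
  have h1 : cotangentChart x₀ z = (q, ξ) := by
    rw [cotangentChart_apply]
    refine Prod.ext ((extChartAt (𝓡 n) x₀).right_inv hq) ?_
    ext v
    change ξ (((trivializationAt (Model n) (TangentSpace (𝓡 n)) x₀).continuousLinearMapAt ℝ
        ((extChartAt (𝓡 n) x₀).symm q)) (((trivializationAt (Model n) (TangentSpace (𝓡 n))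
          x₀).symmL ℝ ((extChartAt (𝓡 n) x₀).symm q)) v)) = ξ v
    rw [Trivialization.continuousLinearMapAt_symmL]
    simpa using hsrc
  rw [← h1, (cotangentChart x₀).left_inv (mem_cotangentChart_source.2 hsrc)]

/-- A change of canonical coordinates is the cotangent lift of the change of base coordinates. -/
lemma cotangentChart_symm_transition {x₀ x₁ : M} {q : Model n}
    (hq : q ∈ (extChartAt (𝓡 n) x₁).target)
    (hq' : (extChartAt (𝓡 n) x₁).symm q ∈ (extChartAt (𝓡 n) x₀).source) (ξ : Covector n) :
    cotangentChart x₀ ((cotangentChart x₁).symm (q, ξ)) =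
      (extChartAt (𝓡 n) x₀ ((extChartAt (𝓡 n) x₁).symm q),
        ξ ∘L tangentCoordChange (𝓡 n) x₀ x₁ ((extChartAt (𝓡 n) x₁).symm q)) := by
  rw [cotangentChart_symm_apply hq, cotangentChart_apply]
  refine Prod.ext rfl ?_
  have hsrc : (extChartAt (𝓡 n) x₁).symm q ∈ (extChartAt (𝓡 n) x₁).source :=
    (extChartAt (𝓡 n) x₁).map_target hq
  dsimp only
  rw [TangentBundle.symmL_trivializationAt_eq_core (by simpa using hq'),
    TangentBundle.continuousLinearMapAt_trivializationAt_eq_core (by simpa using hsrc)]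
  ext v
  change ξ (tangentCoordChange (𝓡 n) _ x₁ _ (tangentCoordChange (𝓡 n) x₀ _ _ v)) = ξ _
  rw [tangentCoordChange_comp ⟨⟨hq', mem_extChartAt_source _⟩, hsrc⟩]
  rfl

lemma mdifferentiableAt_cotangentChart {x₀ : M} {z : CotangentBundle n M}
    (hz : z.proj ∈ (extChartAt (𝓡 n) x₀).source) :
    MDifferentiableAt (cotangentModel n) 𝓘(ℝ, Phase n) (cotangentChart x₀) z := by
  have h := mem_cotangentChart_source.2 hz
  rw [cotangentChart, extChartAt_source] at h
  exact mdifferentiableAt_extChartAt h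

/-- The differential of a change of canonical coordinates preserves the canonical symplectic form.
The second derivative of the coordinate change enters only through a symmetric bilinear form, which
cancels. -/
lemma exists_hasMFDerivAt_cotangentChart {x₀ : M} {z : CotangentBundle n M}
    (hz : z.proj ∈ (extChartAt (𝓡 n) x₀).source) :
    ∃ L : Phase n →L[ℝ] Phase n,
      HasMFDerivAt (cotangentModel n) 𝓘(ℝ, Phase n) (cotangentChart x₀) z L ∧
      ∀ u v : Phase n, (L v).2 (L u).1 - (L u).2 (L v).1 = v.2 u.1 - u.2 v.1 := by
  set x₁ := z.proj with hx₁
  set φ₀ := extChartAt (𝓡 n) x₀ with hφ₀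
  set φ₁ := extChartAt (𝓡 n) x₁ with hφ₁
  set q₁ := φ₁ x₁ with hq₁
  have hx₁s : x₁ ∈ φ₁.source := mem_extChartAt_source x₁
  set θ : Model n → Model n := φ₁ ∘ φ₀.symm with hθ
  set κ : Model n → Model n := φ₀ ∘ φ₁.symm with hκ
  have hκq : κ q₁ = φ₀ x₁ := by simp only [hκ, hq₁, Function.comp_apply, φ₁.left_inv hx₁s]
  set Dκ : Model n →L[ℝ] Model n := tangentCoordChange (𝓡 n) x₁ x₀ x₁ with hDκ
  set Dθ : Model n →L[ℝ] Model n := tangentCoordChange (𝓡 n) x₀ x₁ x₁ with hDθ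
  have hκ' : HasFDerivAt κ Dκ q₁ := by
    have := hasFDerivWithinAt_tangentCoordChange (I := 𝓡 n) (x := x₁) (y := x₀) (z := x₁)
      ⟨hx₁s, hz⟩
    rwa [ModelWithCorners.range_eq_univ, hasFDerivWithinAt_univ] at this
  have hDD : ∀ v, Dθ (Dκ v) = v := fun v => by
    rw [hDθ, hDκ, tangentCoordChange_comp ⟨⟨hx₁s, hz⟩, hx₁s⟩, tangentCoordChange_self hx₁s]
  have hθC : ContDiffAt ℝ ∞ θ (κ q₁) := by
    have h1 : φ₀ x₁ ∈ (φ₀.symm ≫ φ₁).source := by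
      simp only [PartialEquiv.trans_source, PartialEquiv.symm_source, mem_inter_iff, mem_preimage]
      exact ⟨φ₀.map_source hz, by rw [φ₀.left_inv hz]; exact hx₁s⟩
    have h2 := contDiffWithinAt_ext_coord_change (I := 𝓡 n) (n := ∞) x₁ x₀ h1
    rw [hκq]
    rwa [ModelWithCorners.range_eq_univ, contDiffWithinAt_univ] at h2
  have hsymm : IsSymmSndFDerivAt ℝ θ (κ q₁) :=
    hθC.isSymmSndFDerivAt (by simpa using ENat.LEInfty.out)
  set B : Model n →L[ℝ] Model n →L[ℝ] Model n := fderiv ℝ (fderiv ℝ θ) (κ q₁) with hB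
  have hBd : HasFDerivAt (fderiv ℝ θ) B (κ q₁) :=
    ((hθC.fderiv_right (m := 1) (by rw [one_add_one_eq_two]; exact ENat.LEInfty.out)
      ).differentiableAt (by simp)).hasFDerivAt
  have hT : HasFDerivAt (fun q => fderiv ℝ θ (κ q)) (B ∘L Dκ) q₁ :=
    HasFDerivAt.comp q₁ (g := fderiv ℝ θ) hBd hκ'
  have hDθ' : fderiv ℝ θ (κ q₁) = Dθ := by
    rw [hκq, hDθ, tangentCoordChange_def]
    rw [ModelWithCorners.range_eq_univ, fderivWithin_univ]
  set ξ₁ : Covector n := (cotangentChart x₁ z).2 with hξ₁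
  have hzq : cotangentChart x₁ z = (q₁, ξ₁) := by
    refine Prod.ext ?_ rfl
    rw [cotangentChart_apply]
  -- `σ` is the change of canonical coordinates, the cotangent lift of `κ`
  set σ : Phase n → Phase n := fun p => (κ p.1, p.2 ∘L fderiv ℝ θ (κ p.1)) with hσ
  have hκ1 : HasFDerivAt (fun p : Phase n => κ p.1) (Dκ ∘L ContinuousLinearMap.fst ℝ _ _)
      (q₁, ξ₁) := HasFDerivAt.comp (q₁, ξ₁) (g := κ) hκ' hasFDerivAt_fst
  have hT1 : HasFDerivAt (fun p : Phase n => fderiv ℝ θ (κ p.1))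
      ((B ∘L Dκ) ∘L ContinuousLinearMap.fst ℝ _ _) (q₁, ξ₁) :=
    HasFDerivAt.comp (q₁, ξ₁) (g := fun q => fderiv ℝ θ (κ q)) hT hasFDerivAt_fst
  have hσ' := hκ1.prodMk (HasFDerivAt.clm_comp (hasFDerivAt_snd (𝕜 := ℝ) (p := (q₁, ξ₁))) hT1)
  rw [hDθ'] at hσ'
  set L : Phase n →L[ℝ] Phase n := (Dκ ∘L ContinuousLinearMap.fst ℝ _ _).prod
    (ContinuousLinearMap.compL ℝ (Model n) (Model n) ℝ ξ₁ ∘L (B ∘L Dκ) ∘L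
        ContinuousLinearMap.fst ℝ _ _ +
      (ContinuousLinearMap.compL ℝ (Model n) (Model n) ℝ).flip Dθ ∘L
        ContinuousLinearMap.snd ℝ _ _) with hL
  refine ⟨L, ⟨(mdifferentiableAt_cotangentChart hz).continuousAt, ?_⟩, ?_⟩
  · suffices hd : HasFDerivAt (writtenInExtChartAt (cotangentModel n) 𝓘(ℝ, Phase n) z
        (cotangentChart x₀)) L (extChartAt (cotangentModel n) z z) from hd.hasFDerivWithinAt
    rw [extChartAt_cotangent, hzq]
    refine hσ'.congr_of_eventuallyEq ?_
    have h1 : ∀ᶠ q in 𝓝 q₁, q ∈ φ₁.target := extChartAt_target_mem_nhds (I := 𝓡 n) x₁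
    have h2 : ∀ᶠ q in 𝓝 q₁, φ₁.symm q ∈ φ₀.source := by
      have hc : ContinuousAt φ₁.symm q₁ := continuousAt_extChartAt_symm (I := 𝓡 n) x₁
      refine hc.eventually_mem ?_
      rw [hq₁, φ₁.left_inv hx₁s]
      exact (isOpen_extChartAt_source x₀).mem_nhds hz
    filter_upwards [continuousAt_fst.eventually h1, continuousAt_fst.eventually h2] with p hp1 hp2
    rw [writtenInExtChartAt, extChartAt_cotangent]
    change cotangentChart x₀ ((cotangentChart x₁).symm (p.1, p.2)) = _
    rw [cotangentChart_symm_transition hp1 hp2, tangentCoordChange_def,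
      ModelWithCorners.range_eq_univ, fderivWithin_univ]
    rfl
  · intro u v
    have hs := hsymm (Dκ v.1) (Dκ u.1)
    have e : ∀ p, L p = (Dκ p.1, ξ₁ ∘L (B (Dκ p.1)) + p.2 ∘L Dθ) := fun p => rfl
    have hs' : B (Dκ v.1) (Dκ u.1) = B (Dκ u.1) (Dκ v.1) := hs
    simp only [e, add_apply, ContinuousLinearMap.comp_apply, hDD, hs']
    ring

/-- `hamiltonianVectorField`, defined at each point in that point's own chart, is given by
Hamilton's equations in every system of canonical coordinates. -/
lemma exists_hasMFDerivAt_hamiltonianVectorField {x₀ : M} {z : CotangentBundle n M}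
    (hz : z.proj ∈ (extChartAt (𝓡 n) x₀).source) :
    ∃ L : Phase n →L[ℝ] Phase n,
      HasMFDerivAt (cotangentModel n) 𝓘(ℝ, Phase n) (cotangentChart x₀) z L ∧
      Function.Injective L ∧
      ∀ H : CotangentBundle n M → ℝ,
        DifferentiableAt ℝ (H ∘ (cotangentChart x₀).symm) (cotangentChart x₀ z) →
        L (hamiltonianVectorField H z) =
          hamiltonianVector (fderiv ℝ (H ∘ (cotangentChart x₀).symm) (cotangentChart x₀ z)) := by
  obtain ⟨L, hL, hω⟩ := exists_hasMFDerivAt_cotangentChart hz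
  have hinj : Function.Injective L := by
    refine (injective_iff_map_eq_zero L).2 fun u hu => ?_
    have h1 : ∀ v : Phase n, v.2 u.1 - u.2 v.1 = 0 := fun v => by
      rw [← hω u v, hu]; simp
    have h2 : u = hamiltonianVector 0 := eq_hamiltonianVector fun v => by rw [h1 v]; rfl
    have h3 : (0 : Phase n) = hamiltonianVector 0 := eq_hamiltonianVector fun v => by simp
    rw [h2, ← h3]
  refine ⟨L, hL, hinj, fun H hH => ?_⟩
  set h := H ∘ (cotangentChart x₀).symm with hh
  set dh := fderiv ℝ h (cotangentChart x₀ z) with hdh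
  have hsurj : Function.Surjective L := LinearMap.injective_iff_surjective.1 hinj
  have hHd : HasMFDerivAt (cotangentModel n) 𝓘(ℝ, ℝ) H z (dh ∘L L) := by
    have h1 : HasMFDerivAt (cotangentModel n) 𝓘(ℝ, ℝ) (h ∘ cotangentChart x₀) z (dh ∘L L) :=
      HasMFDerivAt.comp z hH.hasFDerivAt.hasMFDerivAt hL
    refine h1.congr_of_eventuallyEq ?_
    have hs : (cotangentChart (n := n) x₀).source ∈ 𝓝 z :=
      (isOpen_extChartAt_source (I := cotangentModel n)
        (⟨x₀, 0⟩ : CotangentBundle n M)).mem_nhds (mem_cotangentChart_source.2 hz)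
    filter_upwards [hs] with y hy
    simp only [hh, Function.comp_apply, (cotangentChart x₀).left_inv hy]
  have hmv : (mvfderiv (cotangentModel n) H z : Phase n →L[ℝ] ℝ) = dh ∘L L := by
    have := hHd.mfderiv
    ext1 v
    change (mfderiv (cotangentModel n) 𝓘(ℝ, ℝ) H z) v = dh (L v)
    rw [this]; rfl
  have hX : (hamiltonianVectorField H z : Phase n) = hamiltonianVector (dh ∘L L) := by
    rw [← hmv]; rfl
  suffices hgen : ∀ X : Phase n, X = hamiltonianVector (dh ∘L L) → L X = hamiltonianVector dh from
    hgen _ hX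
  rintro X rfl
  refine eq_hamiltonianVector fun v => ?_
  obtain ⟨u, rfl⟩ := hsurj v
  rw [hω, ← apply_eq_hamiltonianVector]
  rfl

/-- Integral curves of a Hamiltonian vector field solve Hamilton's equations in coordinates. -/
lemma hasDerivAt_cotangentChart_comp {x₀ : M} {H : CotangentBundle n M → ℝ}
    {z : ℝ → CotangentBundle n M} {t : ℝ}
    (hz : HasMFDerivAt 𝓘(ℝ, ℝ) (cotangentModel n) z t
      ((1 : ℝ →L[ℝ] ℝ).smulRight (hamiltonianVectorField H (z t))))
    (hs : (z t).proj ∈ (extChartAt (𝓡 n) x₀).source)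
    (hH : DifferentiableAt ℝ (H ∘ (cotangentChart x₀).symm) (cotangentChart x₀ (z t))) :
    HasDerivAt (cotangentChart x₀ ∘ z)
      (hamiltonianVector
        (fderiv ℝ (H ∘ (cotangentChart x₀).symm) (cotangentChart x₀ (z t)))) t := by
  obtain ⟨L, hL, -, hLH⟩ := exists_hasMFDerivAt_hamiltonianVectorField hs
  have h1 := (HasMFDerivAt.comp t hL hz).hasFDerivAt
  rw [← hLH H hH, hasDerivAt_iff_hasFDerivAt]
  refine h1.congr_fderiv ?_
  ext1
  exact (congrArg L (one_smul ℝ (hamiltonianVectorField H (z t) : Phase n))).trans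
    (one_smul ℝ _).symm

/-- Solutions of Hamilton's equations in coordinates are integral curves of the Hamiltonian vector
field. -/
lemma hasMFDerivAt_cotangentChart_symm_comp {x₀ : M} {H : CotangentBundle n M → ℝ}
    {ζ : ℝ → Phase n} {t : ℝ} (hs : (ζ t).1 ∈ (extChartAt (𝓡 n) x₀).target)
    (hH : DifferentiableAt ℝ (H ∘ (cotangentChart x₀).symm) (ζ t))
    (hζ : HasDerivAt ζ
      (hamiltonianVector (fderiv ℝ (H ∘ (cotangentChart x₀).symm) (ζ t))) t) :
    HasMFDerivAt 𝓘(ℝ, ℝ) (cotangentModel n) ((cotangentChart x₀).symm ∘ ζ) t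
      ((1 : ℝ →L[ℝ] ℝ).smulRight
        (hamiltonianVectorField H ((cotangentChart x₀).symm (ζ t)))) := by
  have htgt : ζ t ∈ (cotangentChart (n := n) x₀).target := by
    rw [cotangentChart_target]; exact ⟨hs, mem_univ _⟩
  have hsrc := mem_cotangentChart_source.1 ((cotangentChart (n := n) x₀).map_target htgt)
  have hright := (cotangentChart (n := n) x₀).right_inv htgt
  obtain ⟨L, hL, hinj, hLH⟩ := exists_hasMFDerivAt_hamiltonianVectorField hsrc
  rw [hright] at hLH
  have hd : MDifferentiableAt 𝓘(ℝ, Phase n) (cotangentModel n) (cotangentChart x₀).symm (ζ t) := by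
    have := mdifferentiableWithinAt_extChartAt_symm (I := cotangentModel n)
      (x := (⟨x₀, 0⟩ : CotangentBundle n M)) htgt
    rwa [ModelWithCorners.range_eq_univ, mdifferentiableWithinAt_univ] at this
  have hd2 : MDifferentiableAt 𝓘(ℝ, ℝ) (cotangentModel n) ((cotangentChart x₀).symm ∘ ζ) t :=
    MDifferentiableAt.comp t hd hζ.differentiableAt.mdifferentiableAt
  obtain ⟨Y, hY⟩ : ∃ Y : ℝ →L[ℝ] Phase n,
      HasMFDerivAt 𝓘(ℝ, ℝ) (cotangentModel n) ((cotangentChart x₀).symm ∘ ζ) t Y :=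
    ⟨_, hd2.hasMFDerivAt⟩
  have h1 : HasFDerivAt (cotangentChart x₀ ∘ ((cotangentChart x₀).symm ∘ ζ)) (L ∘L Y) t :=
    (HasMFDerivAt.comp t hL hY).hasFDerivAt
  have h2 : ζ =ᶠ[𝓝 t] cotangentChart x₀ ∘ ((cotangentChart x₀).symm ∘ ζ) := by
    have ho : (cotangentChart (n := n) x₀).target ∈ 𝓝 (ζ t) :=
      (isOpen_extChartAt_target (I := cotangentModel n)
        (⟨x₀, 0⟩ : CotangentBundle n M)).mem_nhds htgt
    filter_upwards [hζ.continuousAt ho] with s hs'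
    exact ((cotangentChart (n := n) x₀).right_inv hs').symm
  have h3 := (h1.congr_of_eventuallyEq h2).unique hζ.hasFDerivAt
  have h4 : L (Y 1) = hamiltonianVector (fderiv ℝ (H ∘ (cotangentChart x₀).symm) (ζ t)) := by
    have := DFunLike.congr_fun h3 (1 : ℝ)
    simpa using this
  rw [← hLH H hH] at h4
  have h5 : Y 1 = hamiltonianVectorField H ((cotangentChart x₀).symm (ζ t)) := hinj h4
  refine hY.congr_mfderiv ?_
  rw [← h5]
  ext1
  change Y 1 = (1 : ℝ) • Y 1
  rw [one_smul]

/-! ### Hamilton's equations of the control system in coordinates -/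

section Kinetic

variable {E : Type*} [NormedAddCommGroup E] [NormedSpace ℝ E]

set_option synthInstance.maxHeartbeats 200000 in
/-- The velocity `G q ξ` and the force `k` belonging to a kinetic energy `ξ (G q ξ) / 2`; `k` is
quadratic in the momentum. The momentum lies in an arbitrary space `P` paired with `E` by `B`. -/
lemma exists_fderiv_kinetic {P : Type*} [NormedAddCommGroup P]
    [NormedSpace ℝ P] (B : P →L[ℝ] E →L[ℝ] ℝ) {G : E → P →L[ℝ] E} {q₀ : E}
    (hG : ContDiffAt ℝ 2 G q₀) :
    (∀ p, ContDiffAt ℝ 1 (fun z : E × P => G z.1 z.2) (q₀, p)) ∧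
    HasStrictFDerivAt (fun z : E × P => G z.1 z.2)
      (G q₀ ∘L ContinuousLinearMap.snd ℝ _ _) (q₀, 0) ∧
    ∃ k : E × P → E →L[ℝ] ℝ, (∀ p, ContDiffAt ℝ 1 k (q₀, p)) ∧
      (∀ q (R : ℝ) η, k (q, R • η) = R ^ 2 • k (q, η)) ∧
      ∀ᶠ q in 𝓝 q₀, (∀ ξ μ : P, B ξ (G q μ) = B μ (G q ξ)) → ∀ ξ : P,
        ∃ L : E × P →L[ℝ] ℝ,
          HasFDerivAt (fun z : E × P => B z.2 (G z.1 z.2) * (1 / 2)) L (q, ξ) ∧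
          ∀ v, L v = B v.2 (G q ξ) - k (q, ξ) v.1 := by
  have hG' : ContDiffAt ℝ 1 (fderiv ℝ G) q₀ := hG.fderiv_right (by norm_num)
  obtain ⟨ev, hev⟩ : ∃ ev : P →L[ℝ] (P →L[ℝ] E) →L[ℝ] E, ∀ p T, ev p T = T p :=
    ⟨ContinuousLinearMap.apply ℝ E, fun _ _ => rfl⟩
  refine ⟨fun p => ?_, ?_, fun z => -(1 / 2 : ℝ) • (B z.2 ∘L (ev z.2 ∘L fderiv ℝ G z.1)),
    fun p => ?_, fun q R η => ?_, ?_⟩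
  · have h1 : ContDiffAt ℝ 1 (fun z : E × P => G z.1) (q₀, p) :=
      ContDiffAt.comp (q₀, p) (g := G) (hG.of_le (by norm_num)) contDiffAt_fst
    exact h1.clm_apply contDiffAt_snd
  · have h1 : HasStrictFDerivAt (fun z : E × P => G z.1)
        (fderiv ℝ G q₀ ∘L ContinuousLinearMap.fst ℝ _ _) (q₀, 0) :=
      HasStrictFDerivAt.comp (g := G) (q₀, (0 : P))
        (hG.hasStrictFDerivAt (by norm_num)) hasStrictFDerivAt_fst
    refine (h1.clm_apply hasStrictFDerivAt_snd).congr_fderiv ?_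
    ext v <;> simp
  · have h1 : ContDiffAt ℝ 1 (fun z : E × P => fderiv ℝ G z.1) (q₀, p) :=
      ContDiffAt.comp (q₀, p) (g := fderiv ℝ G) hG' contDiffAt_fst
    have h2 : ContDiffAt ℝ 1 (fun z : E × P => ev z.2) (q₀, p) := by
      fun_prop
    have h3 : ContDiffAt ℝ 1 (fun z : E × P => B z.2) (q₀, p) :=
      B.contDiff.contDiffAt.comp (q₀, p) contDiffAt_snd
    exact (h3.clm_comp (h2.clm_comp h1)).const_smul _
  · ext v
    simp
    ring
  · have e2 : ∀ᶠ q in 𝓝 q₀, DifferentiableAt ℝ G q :=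
      (hG.eventually (by simp)).mono fun q h => h.differentiableAt (by norm_num)
    filter_upwards [e2] with q h2 hsym ξ
    have hGd : HasFDerivAt (fun z : E × P => G z.1)
        (fderiv ℝ G q ∘L ContinuousLinearMap.fst ℝ _ _) (q, ξ) :=
      HasFDerivAt.comp (g := G) (q, ξ) h2.hasFDerivAt hasFDerivAt_fst
    have hkin := (B.hasFDerivAt.comp (q, ξ) (hasFDerivAt_snd (𝕜 := ℝ) (p := (q, ξ)))).clm_apply
      (hGd.clm_apply (hasFDerivAt_snd (𝕜 := ℝ) (p := (q, ξ))))
    refine ⟨_, hkin.mul_const (1 / 2 : ℝ), fun v => ?_⟩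
    have hs := hsym ξ v.2
    simp [hev]
    rw [hs]
    ring

end Kinetic

section Metric

variable {n : ℕ} {M : Type*} [TopologicalSpace M] [ChartedSpace (EuclideanSpace ℝ (Fin n)) M]

lemma contDiffAt_comp_extChartAt_symm {F : Type*} [NormedAddCommGroup F] [NormedSpace ℝ F]
    {k : WithTop ℕ∞} {h : M → F} {x₀ : M} (hh : ContMDiffAt (𝓡 n) 𝓘(ℝ, F) k h x₀) :
    ContDiffAt ℝ k (h ∘ (extChartAt (𝓡 n) x₀).symm) (extChartAt (𝓡 n) x₀ x₀) := by
  have h2 := (contMDiffAt_iff.1 hh).2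
  rw [ModelWithCorners.range_eq_univ, contDiffWithinAt_univ] at h2
  exact h2

variable [RiemannianBundle (fun x : M => TangentSpace (𝓡 n) x)]

/-- The squared dual norm of the covector `p = ⟪v, ·⟫` is `p v`. -/
lemma norm_covector_sq {x : M} {p : TangentSpace (𝓡 n) x →L[ℝ] ℝ} {v : TangentSpace (𝓡 n) x}
    (h : ∀ w, p w = inner ℝ v w) : ‖p‖ ^ 2 = p v := by
  have hp : p = innerSL ℝ v := by ext w; simp [h]
  rw [h, hp, innerSL_apply_norm, real_inner_self_eq_norm_sq]

variable [IsManifold (𝓡 n) ∞ M] [IsContMDiffRiemannianBundle (𝓡 n) ∞ (EuclideanSpace ℝ (Fin n))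
      (fun x : M => TangentSpace (𝓡 n) x)]

/-- The matrix of the metric in the coordinates around `x₀`. -/
lemma exists_metric_coord (x₀ : M) : ∃ g : Model n → Model n →L[ℝ] Covector n,
    ContDiffAt ℝ 2 g (extChartAt (𝓡 n) x₀ x₀) ∧
    ∀ q ∈ (extChartAt (𝓡 n) x₀).target, ∀ v w : Model n, g q v w =
      inner ℝ ((trivializationAt (Model n) (TangentSpace (𝓡 n)) x₀).symmL ℝ
          ((extChartAt (𝓡 n) x₀).symm q) v)
        ((trivializationAt (Model n) (TangentSpace (𝓡 n)) x₀).symmL ℝ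
          ((extChartAt (𝓡 n) x₀).symm q) w) := by
  obtain ⟨g, hg, hgi⟩ := IsContMDiffRiemannianBundle.exists_contMDiff (IB := 𝓡 n) (n := ∞)
    (F := EuclideanSpace ℝ (Fin n)) (E := fun x : M => TangentSpace (𝓡 n) x)
  set g' : M → Model n →L[ℝ] Covector n := fun y =>
    ContinuousLinearMap.inCoordinates (Model n) (TangentSpace (𝓡 n)) (Model n →L[ℝ] ℝ)
      (fun x : M => TangentSpace (𝓡 n) x →L[ℝ] ℝ) x₀ y x₀ y (g y) with hg'
  have h1 : ContMDiffAt (𝓡 n) 𝓘(ℝ, Model n →L[ℝ] Covector n) 2 g' x₀ :=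
    ((contMDiffAt_hom_bundle _).1 (hg x₀)).2.of_le ENat.LEInfty.out
  refine ⟨g' ∘ (extChartAt (𝓡 n) x₀).symm, contDiffAt_comp_extChartAt_symm h1,
    fun q hq v w => ?_⟩
  have hs : (extChartAt (𝓡 n) x₀).symm q ∈
      (trivializationAt (Model n) (TangentSpace (𝓡 n)) x₀).baseSet := by
    simpa using (extChartAt (𝓡 n) x₀).map_target hq
  simp only [Function.comp_apply, hg', hgi]
  rw [inCoordinates_apply_eq₂ hs hs (Set.mem_univ _)]
  simp only [Trivialization.symmL_apply _ hs]
  simp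

/-- The dual metric in canonical coordinates: the kinetic energy is `ξ (G q ξ) / 2`, with `G q`
symmetric and invertible. -/
lemma exists_dualMetric_coord (x₀ : M) : ∃ G : Model n → Covector n →L[ℝ] Model n,
    ContDiffAt ℝ 2 G (extChartAt (𝓡 n) x₀ x₀) ∧
    (∃ A : Covector n ≃L[ℝ] Model n, (A : Covector n →L[ℝ] Model n) =
      G (extChartAt (𝓡 n) x₀ x₀)) ∧
    ∀ q ∈ (extChartAt (𝓡 n) x₀).target, (∀ ξ μ : Covector n, ξ (G q μ) = μ (G q ξ)) ∧
      ∀ ξ : Covector n, ‖((cotangentChart x₀).symm (q, ξ)).2‖ ^ 2 = ξ (G q ξ) := by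
  obtain ⟨g, hg, hgi⟩ := exists_metric_coord (n := n) x₀
  have hinv : ∀ q ∈ (extChartAt (𝓡 n) x₀).target, ∃ e : Model n ≃L[ℝ] Covector n,
      (e : Model n →L[ℝ] Covector n) = g q := by
    intro q hq
    have hs : (extChartAt (𝓡 n) x₀).symm q ∈
        (trivializationAt (Model n) (TangentSpace (𝓡 n)) x₀).baseSet := by
      simpa using (extChartAt (𝓡 n) x₀).map_target hq
    have hinj : Function.Injective (g q : Model n →ₗ[ℝ] Covector n) := by
      refine (injective_iff_map_eq_zero _).2 fun v hv => ?_
      have h0 : g q v v = 0 := by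
        have : g q v = 0 := hv
        rw [this]; rfl
      rw [hgi q hq, inner_self_eq_zero] at h0
      rw [← (trivializationAt (Model n) (TangentSpace (𝓡 n)) x₀).continuousLinearMapAt_symmL
        (R := ℝ) hs v, h0, map_zero]
    have hfin : Module.finrank ℝ (Model n) = Module.finrank ℝ (Covector n) := by
      rw [finrank_covector, finrank_euclideanSpace_fin]
    refine ⟨(LinearEquiv.ofInjectiveOfFinrankEq _ hinj hfin).toContinuousLinearEquiv, ?_⟩
    ext1 v
    rfl
  have hq₀ := mem_extChartAt_target (I := 𝓡 n) x₀
  obtain ⟨e₀, he₀⟩ := hinv _ hq₀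
  refine ⟨fun q => (g q).inverse, ?_, ⟨e₀.symm, ?_⟩, fun q hq => ?_⟩
  · have := contDiffAt_map_inverse (n := 2) e₀
    rw [he₀] at this
    exact this.comp _ hg
  · simp only [← he₀, ContinuousLinearMap.inverse_equiv]
  · obtain ⟨e, he⟩ := hinv q hq
    have hs : (extChartAt (𝓡 n) x₀).symm q ∈
        (trivializationAt (Model n) (TangentSpace (𝓡 n)) x₀).baseSet := by
      simpa using (extChartAt (𝓡 n) x₀).map_target hq
    have hG : ∀ ξ : Covector n, g q ((g q).inverse ξ) = ξ := fun ξ => by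
      rw [← he, ContinuousLinearMap.inverse_equiv]
      exact e.apply_symm_apply ξ
    refine ⟨fun ξ μ => ?_, fun ξ => ?_⟩
    · conv_lhs => rw [← hG ξ]
      conv_rhs => rw [← hG μ]
      rw [hgi q hq, hgi q hq, real_inner_comm]
    · rw [cotangentChart_symm_apply hq]
      set T := trivializationAt (Model n) (TangentSpace (𝓡 n)) x₀
      set x := (extChartAt (𝓡 n) x₀).symm q
      set v := (g q).inverse ξ with hv
      rw [norm_covector_sq (v := T.symmL ℝ x v)]
      · change ξ (T.continuousLinearMapAt ℝ x (T.symmL ℝ x v)) = ξ v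
        rw [Trivialization.continuousLinearMapAt_symmL _ hs]
      · intro w
        change ξ (T.continuousLinearMapAt ℝ x w) = _
        conv_lhs => rw [← hG ξ]
        rw [hgi q hq]
        change inner ℝ (T.symmL ℝ x v) (T.symmL ℝ x (T.continuousLinearMapAt ℝ x w)) = _
        rw [Trivialization.symmL_continuousLinearMapAt _ hs]

end Metric

section Hamiltonian

variable {n : ℕ} {M : Type*} [TopologicalSpace M] [ChartedSpace (EuclideanSpace ℝ (Fin n)) M]
  [IsManifold (𝓡 n) ∞ M] [RiemannianBundle (fun x : M => TangentSpace (𝓡 n) x)]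
  [IsContMDiffRiemannianBundle (𝓡 n) ∞ (EuclideanSpace ℝ (Fin n))
      (fun x : M => TangentSpace (𝓡 n) x)]

/-- Hamilton's equations in canonical coordinates: `q̇ = f (q, ξ)`,
`ξ̇ = k (q, ξ) - dV - ∑ c_i dW_i`, where `f` is linear and `k` quadratic in the momentum. -/
lemma exists_hamilton_coord {V : M → ℝ} {W : Fin n → M → ℝ} (x₀ : M)
    (hV : ContMDiff (𝓡 n) 𝓘(ℝ, ℝ) 2 V) (hW : ∀ i, ContMDiff (𝓡 n) 𝓘(ℝ, ℝ) 2 (W i)) :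
    ∃ (f : Phase n → Model n) (k : Phase n → Covector n),
      (∀ p, ContDiffAt ℝ 1 f (extChartAt (𝓡 n) x₀ x₀, p)) ∧
      (∀ p, ContDiffAt ℝ 1 k (extChartAt (𝓡 n) x₀ x₀, p)) ∧
      (∃ A : Covector n ≃L[ℝ] Model n, HasStrictFDerivAt f
        ((A : Covector n →L[ℝ] Model n) ∘L ContinuousLinearMap.snd ℝ _ _)
        (extChartAt (𝓡 n) x₀ x₀, 0)) ∧
      (∀ q, f (q, 0) = 0) ∧
      (∀ q (R : ℝ) η, f (q, R • η) = R • f (q, η)) ∧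
      (∀ q (R : ℝ) η, k (q, R • η) = R ^ 2 • k (q, η)) ∧
      ∀ᶠ q in 𝓝 (extChartAt (𝓡 n) x₀ x₀), q ∈ (extChartAt (𝓡 n) x₀).target ∧ ∀ c ξ,
        DifferentiableAt ℝ (controlHamiltonian V W c ∘ (cotangentChart x₀).symm) (q, ξ) ∧
        hamiltonianVector (fderiv ℝ (controlHamiltonian V W c ∘ (cotangentChart x₀).symm)
          (q, ξ)) = (f (q, ξ), k (q, ξ) - fderiv ℝ (V ∘ (extChartAt (𝓡 n) x₀).symm) q
            - ∑ i, c i • fderiv ℝ (W i ∘ (extChartAt (𝓡 n) x₀).symm) q) := by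
  obtain ⟨G, hG, ⟨A, hA⟩, hGq⟩ := exists_dualMetric_coord (n := n) x₀
  set q₀ := extChartAt (𝓡 n) x₀ x₀ with hq₀
  have hVc := contDiffAt_comp_extChartAt_symm (hV x₀)
  have hWc := fun i => contDiffAt_comp_extChartAt_symm (hW i x₀)
  set V' := V ∘ (extChartAt (𝓡 n) x₀).symm with hV'
  set W' := fun i => W i ∘ (extChartAt (𝓡 n) x₀).symm with hW'
  obtain ⟨hf, hfs, k, hk, hkR, hkd⟩ :=
    exists_fderiv_kinetic (ContinuousLinearMap.id ℝ (Covector n)) hG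
  refine ⟨fun z => G z.1 z.2, k, hf, hk, ⟨A, by rwa [hA]⟩, fun q => map_zero _,
    fun q R η => map_smul _ _ _, hkR, ?_⟩
  have e1 : ∀ᶠ q in 𝓝 q₀, q ∈ (extChartAt (𝓡 n) x₀).target :=
    extChartAt_target_mem_nhds (I := 𝓡 n) x₀
  have e3 : ∀ᶠ q in 𝓝 q₀, DifferentiableAt ℝ V' q :=
    (hVc.eventually (by simp)).mono fun q h => h.differentiableAt (by norm_num)
  have e4 : ∀ᶠ q in 𝓝 q₀, ∀ i, DifferentiableAt ℝ (W' i) q :=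
    Filter.eventually_all.2 fun i =>
      ((hWc i).eventually (by simp)).mono fun q h => h.differentiableAt (by norm_num)
  filter_upwards [e1.eventually_nhds, hkd, e3, e4] with q h1 h2 h3 h4
  refine ⟨h1.self_of_nhds, fun c ξ => ?_⟩
  obtain ⟨L, hL, hLv⟩ := h2 (hGq q h1.self_of_nhds).1 ξ
  have hVd : HasFDerivAt (fun z : Phase n => V' z.1)
      (fderiv ℝ V' q ∘L ContinuousLinearMap.fst ℝ _ _) (q, ξ) :=
    HasFDerivAt.comp (g := V') (q, ξ) h3.hasFDerivAt hasFDerivAt_fst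
  have hWd : ∀ i, HasFDerivAt (fun z : Phase n => c i * W' i z.1)
      (c i • (fderiv ℝ (W' i) q ∘L ContinuousLinearMap.fst ℝ _ _)) (q, ξ) := fun i =>
    (HasFDerivAt.comp (g := W' i) (q, ξ) (h4 i).hasFDerivAt hasFDerivAt_fst).const_mul (c i)
  have hH := (hL.add hVd).add (HasFDerivAt.fun_sum (u := Finset.univ) fun i _ => hWd i)
  have hev : controlHamiltonian V W c ∘ (cotangentChart x₀).symm =ᶠ[𝓝 (q, ξ)]
      fun z : Phase n => z.2 (G z.1 z.2) * (1 / 2) + V' z.1 + ∑ i, c i * W' i z.1 := by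
    filter_upwards [continuousAt_fst.eventually h1] with z hz
    have hp : ((cotangentChart x₀).symm z).proj = (extChartAt (𝓡 n) x₀).symm z.1 := by
      rw [← Prod.mk.eta (p := z), cotangentChart_symm_apply hz]
    have hn := (hGq z.1 hz).2 z.2
    simp only [Function.comp_apply, controlHamiltonian, hp, hV', hW']
    rw [← hn]
    ring
  have hH' := hH.congr_of_eventuallyEq hev
  refine ⟨hH'.differentiableAt, ?_⟩
  rw [hH'.fderiv]
  refine (eq_hamiltonianVector fun v => ?_).symm
  have hWe : ∀ i, W i ∘ (extChartAt (𝓡 n) x₀).symm = W' i := fun _ => rfl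
  simp only [hWe]
  simp [hLv]
  ring

end Hamiltonian

/-! ### Reachable sets and robust steering -/

section Reach

variable {n : ℕ} {M : Type*} [TopologicalSpace M] [ChartedSpace (EuclideanSpace ℝ (Fin n)) M]
  [IsManifold (𝓡 n) ∞ M]

lemma hasMFDerivAt_hamiltonianVectorField_congr {H : CotangentBundle n M → ℝ}
    {z z' : ℝ → CotangentBundle n M} {t : ℝ}
    (h : HasMFDerivAt 𝓘(ℝ, ℝ) (cotangentModel n) z t
      ((1 : ℝ →L[ℝ] ℝ).smulRight (hamiltonianVectorField H (z t)))) (he : z' =ᶠ[𝓝 t] z) :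
    HasMFDerivAt 𝓘(ℝ, ℝ) (cotangentModel n) z' t
      ((1 : ℝ →L[ℝ] ℝ).smulRight (hamiltonianVectorField H (z' t))) := by
  have h2 : ∀ a b : CotangentBundle n M, a = b →
      ((1 : ℝ →L[ℝ] ℝ).smulRight (hamiltonianVectorField H a : Phase n)) =
      ((1 : ℝ →L[ℝ] ℝ).smulRight (hamiltonianVectorField H b : Phase n)) := by
    rintro a b rfl; rfl
  exact (h.congr_of_eventuallyEq he).congr_mfderiv (h2 _ _ he.eq_of_nhds.symm)

lemma hasMFDerivAt_hamiltonianVectorField_comp_sub {H : CotangentBundle n M → ℝ}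
    {z : ℝ → CotangentBundle n M} {t s : ℝ}
    (h : HasMFDerivAt 𝓘(ℝ, ℝ) (cotangentModel n) z (t - s)
      ((1 : ℝ →L[ℝ] ℝ).smulRight (hamiltonianVectorField H (z (t - s))))) :
    HasMFDerivAt 𝓘(ℝ, ℝ) (cotangentModel n) (fun r => z (r - s)) t
      ((1 : ℝ →L[ℝ] ℝ).smulRight (hamiltonianVectorField H (z (t - s)))) := by
  have hd : HasMFDerivAt 𝓘(ℝ, ℝ) 𝓘(ℝ, ℝ) (fun r : ℝ => r - s) t
      (ContinuousLinearMap.id ℝ ℝ) :=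
    ((hasFDerivAt_id t).sub_const s).hasMFDerivAt
  exact (HasMFDerivAt.comp t h hd).congr_mfderiv (ContinuousLinearMap.comp_id _)

variable [RiemannianBundle (fun x : M => TangentSpace (𝓡 n) x)]
  {V : M → ℝ} {W : Fin n → M → ℝ}

lemma isPiecewiseConstant_concat {u₁ u₂ : ℝ → Fin n → ℝ} {s₁ s₂ : ℝ}
    (h₁ : IsPiecewiseConstant u₁ s₁) (h₂ : IsPiecewiseConstant u₂ s₂) :
    IsPiecewiseConstant (fun t => if t ≤ s₁ then u₁ t else u₂ (t - s₁)) (s₁ + s₂) := by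
  obtain ⟨F₁, hF₁⟩ := h₁
  obtain ⟨F₂, hF₂⟩ := h₂
  refine ⟨insert s₁ (F₁ ∪ F₂.image (· + s₁)), fun a b hab => ?_⟩
  rcases le_or_gt b s₁ with hb | hb
  · obtain ⟨c, hc⟩ := hF₁ a b fun t ht => by
      have h := hab ht
      refine ⟨⟨h.1.1, (ht.2.trans_le hb).le⟩, fun hF => h.2 ?_⟩
      simp only [Finset.mem_coe] at hF
      simp [hF]
    exact ⟨c, fun t ht => (if_pos (ht.2.le.trans hb)).trans (hc t ht)⟩
  · have ha : s₁ ≤ a := by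
      by_contra! ha
      exact (hab ⟨ha, hb⟩).2 (by simp)
    obtain ⟨c, hc⟩ := hF₂ (a - s₁) (b - s₁) fun t ht => by
      have h := hab (show t + s₁ ∈ Ioo a b from ⟨by linarith [ht.1], by linarith [ht.2]⟩)
      refine ⟨⟨by linarith [ht.1], by linarith [h.1.2]⟩, fun hF => h.2 ?_⟩
      simp only [Finset.mem_coe] at hF
      simp [hF]
    refine ⟨c, fun t ht => ?_⟩
    exact (if_neg (ha.trans_lt ht.1).not_ge).trans
      (hc _ ⟨by linarith [ht.1], by linarith [ht.2]⟩)

lemma isClassicalSolution_concat {u₁ u₂ : ℝ → Fin n → ℝ} {s₁ s₂ : ℝ}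
    {z₁ z₂ : ℝ → CotangentBundle n M} (h₁ : IsClassicalSolution V W u₁ s₁ z₁)
    (h₂ : IsClassicalSolution V W u₂ s₂ z₂) (h : z₁ s₁ = z₂ 0) :
    IsClassicalSolution V W (fun t => if t ≤ s₁ then u₁ t else u₂ (t - s₁)) (s₁ + s₂)
      (fun t => if t ≤ s₁ then z₁ t else z₂ (t - s₁)) := by
  obtain ⟨hc₁, F₁, hF₁⟩ := h₁
  obtain ⟨hc₂, F₂, hF₂⟩ := h₂
  refine ⟨?_, insert s₁ (F₁ ∪ F₂.image (· + s₁)), fun t ht => ?_⟩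
  · refine ContinuousOn.if ?_ ?_ ?_
    · rintro t ⟨-, ht⟩
      have : t = s₁ := by simpa using frontier_le_subset_eq continuous_id continuous_const ht
      rw [this, h, sub_self]
    · refine hc₁.mono fun t ht => ⟨ht.1.1, ?_⟩
      exact (closure_le_eq (continuous_id (X := ℝ)) continuous_const).subset ht.2
    · refine hc₂.comp (continuous_sub_right s₁).continuousOn fun t ht => ?_
      have h1 : s₁ ≤ t := by
        have := closure_lt_subset_le (f := fun _ : ℝ => s₁) (g := fun t : ℝ => t)
          continuous_const continuous_id
        exact this (by simpa only [not_le] using ht.2)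
      exact ⟨by linarith, by linarith [ht.1.2]⟩
  · have htF : t ≠ s₁ ∧ t ∉ F₁ ∧ t - s₁ ∉ F₂ := by
      have := ht.2
      simp only [Finset.coe_insert, Finset.coe_union, Finset.coe_image, mem_insert_iff, mem_union,
        Finset.mem_coe, mem_image, not_or] at this
      exact ⟨this.1, this.2.1, fun hF => this.2.2 ⟨_, hF, by ring⟩⟩
    rcases lt_or_gt_of_ne htF.1 with hlt | hgt
    · have := hF₁ t ⟨⟨ht.1.1, hlt⟩, htF.2.1⟩
      simp only [if_pos hlt.le]
      refine hasMFDerivAt_hamiltonianVectorField_congr this ?_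
      filter_upwards [Iio_mem_nhds hlt] with r hr
      exact if_pos (le_of_lt hr)
    · have := hF₂ (t - s₁) ⟨⟨by linarith, by linarith [ht.1.2]⟩, htF.2.2⟩
      simp only [if_neg hgt.not_ge]
      refine hasMFDerivAt_hamiltonianVectorField_congr
        (hasMFDerivAt_hamiltonianVectorField_comp_sub this) ?_
      filter_upwards [Ioi_mem_nhds hgt] with r hr
      exact if_neg (not_le.2 hr)

lemma classicalReachableSet_trans {S T : ℝ} {z₁ z₂ z₃ : CotangentBundle n M}
    (h₁ : z₂ ∈ classicalReachableSet V W S z₁) (h₂ : z₃ ∈ classicalReachableSet V W T z₂) :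
    z₃ ∈ classicalReachableSet V W (S + T) z₁ := by
  obtain ⟨s₁, hs₁, hs₁S, u₁, hu₁, ζ₁, hζ₁, h0₁, h1₁⟩ := h₁
  obtain ⟨s₂, hs₂, hs₂T, u₂, hu₂, ζ₂, hζ₂, h0₂, h1₂⟩ := h₂
  refine ⟨s₁ + s₂, by positivity, by gcongr, _, isPiecewiseConstant_concat hu₁ hu₂, _,
    isClassicalSolution_concat hζ₁ hζ₂ (h1₁.trans h0₂.symm), by simp [hs₁, h0₁], ?_⟩
  rcases hs₂.eq_or_lt with rfl | hs
  · simp [h1₁, ← h1₂, h0₂]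
  · simp [hs.not_ge, h1₂]

variable (V W) in
/-- `z₁` can be steered to `z₂` in time `T`, robustly: all states near `z₁` can be brought, in time
at most `T`, as close to `z₂` as desired. Unlike mere membership in the closure of the reachable
set, this relation is transitive. -/
def Steers (T : ℝ) (z₁ z₂ : CotangentBundle n M) : Prop :=
  ∀ N ∈ 𝓝 z₂, ∀ᶠ z in 𝓝 z₁, (classicalReachableSet V W T z ∩ N).Nonempty

lemma Steers.trans {S T : ℝ} {z₁ z₂ z₃ : CotangentBundle n M} (h₁ : Steers V W S z₁ z₂)
    (h₂ : Steers V W T z₂ z₃) : Steers V W (S + T) z₁ z₃ := by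
  intro N hN
  filter_upwards [h₁ _ (h₂ N hN)] with z hz
  obtain ⟨y, hy, hy'⟩ := hz
  obtain ⟨y', hy1, hy2⟩ := hy'
  exact ⟨y', classicalReachableSet_trans hy hy1, hy2⟩

lemma Steers.mem_closure {T : ℝ} {z₁ z₂ : CotangentBundle n M} (h : Steers V W T z₁ z₂) :
    z₂ ∈ closure (classicalReachableSet V W T z₁) :=
  mem_closure_iff_nhds.2 fun N hN => by
    rw [inter_comm]; exact (h N hN).self_of_nhds

/-- On `B`, the system driven by the constant control `c` is Hamilton's system
`q̇ = f`, `ξ̇ = k - dV - ∑ c_i dW_i` in the canonical coordinates around `x₀`. -/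
def IsHamiltonCoordOn (V : M → ℝ) (W : Fin n → M → ℝ) (x₀ : M) (f : Phase n → Model n)
    (k : Phase n → Covector n) (B : Set (Model n)) : Prop :=
  ∀ q ∈ B, q ∈ (extChartAt (𝓡 n) x₀).target ∧ ∀ c ξ,
    DifferentiableAt ℝ (controlHamiltonian V W c ∘ (cotangentChart x₀).symm) (q, ξ) ∧
    hamiltonianVector (fderiv ℝ (controlHamiltonian V W c ∘ (cotangentChart x₀).symm)
      (q, ξ)) = (f (q, ξ), k (q, ξ) - fderiv ℝ (V ∘ (extChartAt (𝓡 n) x₀).symm) q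
        - ∑ i, c i • fderiv ℝ (W i ∘ (extChartAt (𝓡 n) x₀).symm) q)

/-- A trajectory of the rescaled field is, after the change of variables `ξ = R η`,
`t = τ s`, a solution of the control system over the time interval `[0, τ]`, driven by the constant
control `(R γ / τ) c`. -/
lemma IsTrajectory.mem_classicalReachableSet {x₀ : M} {f : Phase n → Model n}
    {k : Phase n → Covector n} {q₀ : Model n} {p₀ : Covector n} {a : ℝ}
    (hB : IsHamiltonCoordOn V W x₀ f k (Metric.closedBall q₀ a))
    (hf : ∀ q (R : ℝ) η, f (q, R • η) = R • f (q, η))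
    (hk : ∀ q (R : ℝ) η, k (q, R • η) = R ^ 2 • k (q, η)) {τ R γ T : ℝ} (hτ : 0 < τ)
    (hR : 0 < R) (hT : τ ≤ T) (c : Fin n → ℝ) {z : Phase n} {ζ : ℝ → Phase n}
    (h : IsTrajectory (scaledField f k
      (fun q => -fderiv ℝ (V ∘ (extChartAt (𝓡 n) x₀).symm) q)
      (fun q => -∑ i, c i • fderiv ℝ (W i ∘ (extChartAt (𝓡 n) x₀).symm) q)
      (τ * R) (τ / R) γ) (q₀, p₀) a z ζ) :
    (cotangentChart x₀).symm ((ζ 1).1, R • (ζ 1).2) ∈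
      classicalReachableSet V W T ((cotangentChart x₀).symm (z.1, R • z.2)) := by
  have hmem : ∀ t ∈ Icc (0 : ℝ) 1, (ζ t).1 ∈ Metric.closedBall q₀ a := fun t ht => by
    have := h.mem t ht
    rw [← closedBall_prod_same] at this
    exact this.1
  set ρ : ℝ → Phase n := fun t => ((ζ (t / τ)).1, R • (ζ (t / τ)).2) with hρ
  have hdiv : ∀ t ∈ Icc 0 τ, t / τ ∈ Icc (0 : ℝ) 1 := fun t ht =>
    ⟨div_nonneg ht.1 hτ.le, (div_le_one hτ).2 ht.2⟩
  have hρt : ∀ t ∈ Icc 0 τ, ρ t ∈ (cotangentChart (n := n) x₀).target := fun t ht => by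
    rw [cotangentChart_target]
    exact ⟨(hB _ (hmem _ (hdiv t ht))).1, mem_univ _⟩
  have hρc : ContinuousOn ρ (Icc 0 τ) := by
    have h1 : ContinuousOn (fun t => ζ (t / τ)) (Icc 0 τ) :=
      h.continuousOn.comp (continuous_id.div_const τ).continuousOn hdiv
    exact (continuous_fst.comp_continuousOn h1).prodMk
      ((continuous_snd.comp_continuousOn h1).const_smul R)
  refine ⟨τ, hτ.le, hT, fun _ => (R * γ / τ) • c, ⟨∅, fun _ _ _ => ⟨_, fun _ _ => rfl⟩⟩,
    (cotangentChart x₀).symm ∘ ρ, ⟨?_, ∅, fun t ht => ?_⟩, ?_, ?_⟩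
  · exact (continuousOn_extChartAt_symm (I := cotangentModel n)
      (⟨x₀, 0⟩ : CotangentBundle n M)).comp hρc hρt
  · have ht' : t ∈ Icc 0 τ := Ioo_subset_Icc_self ht.1
    obtain ⟨htg, hH⟩ := hB _ (hmem _ (hdiv t ht'))
    obtain ⟨hHd, hHv⟩ := hH ((R * γ / τ) • c) (R • (ζ (t / τ)).2)
    refine hasMFDerivAt_cotangentChart_symm_comp (ζ := ρ) htg hHd ?_
    have hd : HasDerivAt ζ _ (t / τ) := (h.deriv (t / τ) (hdiv t ht')).hasDerivAt
      (Icc_mem_nhds (div_pos ht.1.1 hτ) ((div_lt_one hτ).2 ht.1.2))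
    have hd2 : HasDerivAt (fun t => ζ (t / τ)) _ t :=
      HasDerivAt.scomp (h := fun t => t / τ) t hd ((hasDerivAt_id t).div_const τ)
    have hd3 := ((hasFDerivAt_fst (𝕜 := ℝ)).comp_hasDerivAt t hd2).prodMk
      (((hasFDerivAt_snd (𝕜 := ℝ)).comp_hasDerivAt t hd2).const_smul R)
    refine hd3.congr_deriv ?_
    have e : (ρ t) = ((ζ (t / τ)).1, R • (ζ (t / τ)).2) := rfl
    rw [e, hHv, hf, hk]
    simp only [scaledField]
    refine Prod.ext ?_ ?_
    · simp only [ContinuousLinearMap.coe_fst', Prod.smul_fst, smul_smul]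
      congr 1
      field_simp
    · simp only [ContinuousLinearMap.coe_snd', Prod.smul_snd, smul_add, smul_neg, smul_smul,
        Finset.smul_sum, Pi.smul_apply, smul_eq_mul]
      have e1 : R * (1 / τ * (τ * R)) = R ^ 2 := by field_simp
      have e2 : R * (1 / τ * (τ / R)) = 1 := by field_simp
      have e3 : R * (1 / τ * γ) = R * γ / τ := by ring
      simp only [← mul_assoc] at e1 e2 e3 ⊢
      rw [e1, e2]
      simp only [one_smul, e3]
      rw [← sub_eq_add_neg, ← sub_eq_add_neg]
  · simp [hρ, h.init]
  · simp [hρ, hτ.ne']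

end Reach

/-! ### Kicks and fast geodesics -/

section Degeneracy

variable {n : ℕ} {M : Type*} [TopologicalSpace M] [ChartedSpace (EuclideanSpace ℝ (Fin n)) M]

lemma mvfderiv_eq_fderiv {h : M → ℝ} {x : M} (hh : MDifferentiableAt (𝓡 n) 𝓘(ℝ, ℝ) h x) :
    (mvfderiv (𝓡 n) h x : Covector n) =
      fderiv ℝ (h ∘ (extChartAt (𝓡 n) x).symm) (extChartAt (𝓡 n) x x) := by
  have h1 := hh.mfderiv
  rw [ModelWithCorners.range_eq_univ, fderivWithin_univ] at h1
  ext1 v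
  exact DFunLike.congr_fun h1 v

/-- Off the degeneracy set the differentials `dW_i` span the cotangent space, so that every force
is available. -/
lemma exists_sum_smul_fderiv_eq {W : Fin n → M → ℝ}
    (hW : ∀ i, ContMDiff (𝓡 n) 𝓘(ℝ, ℝ) 2 (W i)) {x : M} (hx : x ∉ degeneracySet W)
    (μ : Covector n) : ∃ c : Fin n → ℝ,
      ∑ i, c i • fderiv ℝ (W i ∘ (extChartAt (𝓡 n) x).symm) (extChartAt (𝓡 n) x x) = μ := by
  set b : Fin n → Covector n := fun i =>
    fderiv ℝ (W i ∘ (extChartAt (𝓡 n) x).symm) (extChartAt (𝓡 n) x x) with hb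
  have hWb : (fun i => (mvfderiv (𝓡 n) (W i) x : Covector n)) = b :=
    funext fun i => mvfderiv_eq_fderiv ((hW i).mdifferentiable (by norm_num) x)
  have hlin : LinearIndependent ℝ b := by
    by_contra h
    have h0 : exteriorPower.ιMulti ℝ n b = 0 :=
      (exteriorPower.ιMulti ℝ n).map_linearDependent _ h
    rw [← hWb] at h0
    exact hx h0
  have hspan := hlin.span_eq_top_of_card_eq_finrank' (by rw [finrank_covector, Fintype.card_fin])
  exact (Submodule.mem_span_range_iff_exists_fun ℝ).1 (by rw [hspan]; trivial)

end Degeneracy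

section Steering

variable {n : ℕ} {M : Type*} [TopologicalSpace M] [ChartedSpace (EuclideanSpace ℝ (Fin n)) M]
  [IsManifold (𝓡 n) ∞ M]

/-- Canonical coordinates with the momentum divided by `R`. -/
noncomputable def scaledChart (x₀ : M) (R : ℝ) (z : CotangentBundle n M) : Phase n :=
  ((cotangentChart x₀ z).1, R⁻¹ • (cotangentChart x₀ z).2)

lemma continuousAt_scaledChart {x₀ : M} (R : ℝ) {z : CotangentBundle n M}
    (hz : z.proj ∈ (extChartAt (𝓡 n) x₀).source) : ContinuousAt (scaledChart x₀ R) z := by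
  have h := (mdifferentiableAt_cotangentChart hz).continuousAt
  have h2 : Continuous fun y : Phase n => (y.1, R⁻¹ • y.2) := by fun_prop
  exact h2.continuousAt.comp h

lemma symm_scaledChart {x₀ : M} {R : ℝ} (hR : R ≠ 0) {z : CotangentBundle n M}
    (hz : z.proj ∈ (extChartAt (𝓡 n) x₀).source) :
    (cotangentChart x₀).symm ((scaledChart x₀ R z).1, R • (scaledChart x₀ R z).2) = z := by
  simp only [scaledChart, smul_inv_smul₀ hR]
  exact (cotangentChart x₀).left_inv (mem_cotangentChart_source.2 hz)

lemma continuousAt_symm_smul {x₀ : M} (R : ℝ) {y : Phase n}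
    (hy : y.1 ∈ (extChartAt (𝓡 n) x₀).target) :
    ContinuousAt (fun y : Phase n => (cotangentChart x₀).symm (y.1, R • y.2)) y := by
  have h1 : (y.1, R • y.2) ∈ (cotangentChart (n := n) x₀).target := by
    rw [cotangentChart_target]; exact ⟨hy, mem_univ _⟩
  have h2 : ContinuousAt (cotangentChart (n := n) x₀).symm (y.1, R • y.2) :=
    continuousAt_extChartAt_symm'' (I := cotangentModel n) h1
  have h3 : ContinuousAt (fun y : Phase n => (y.1, R • y.2)) y := by fun_prop
  exact ContinuousAt.comp (f := fun y : Phase n => (y.1, R • y.2)) h2 h3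

variable [RiemannianBundle (fun x : M => TangentSpace (𝓡 n) x)]
  {V : M → ℝ} {W : Fin n → M → ℝ}

/-- If trajectories of the rescaled system starting near the scaled coordinates of `z₁` end near
those of `z₂`, then `z₁` can be steered to `z₂`. -/
lemma steers_of_scaledChart {x₀ : M} {T R : ℝ} (hR : R ≠ 0) {z₁ z₂ : CotangentBundle n M}
    (h₁ : z₁.proj ∈ (extChartAt (𝓡 n) x₀).source) (h₂ : z₂.proj ∈ (extChartAt (𝓡 n) x₀).source)
    (h : ∀ ε > 0, ∃ δ > 0, ∀ y : Phase n, ‖y - scaledChart x₀ R z₁‖ < δ →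
      ∃ y' : Phase n, ‖y' - scaledChart x₀ R z₂‖ < ε ∧
        (cotangentChart x₀).symm (y'.1, R • y'.2) ∈
          classicalReachableSet V W T ((cotangentChart x₀).symm (y.1, R • y.2))) :
    Steers V W T z₁ z₂ := by
  intro N hN
  have hc : ContinuousAt (fun y : Phase n => (cotangentChart x₀).symm (y.1, R • y.2))
      (scaledChart x₀ R z₂) := continuousAt_symm_smul R (by
    simp only [scaledChart, cotangentChart_apply]
    exact (extChartAt (𝓡 n) x₀).map_source h₂)
  have hN' := hc.preimage_mem_nhds (by rwa [symm_scaledChart hR h₂])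
  obtain ⟨ε, hε, hεN⟩ := Metric.mem_nhds_iff.1 hN'
  obtain ⟨δ, hδ, hδ'⟩ := h ε hε
  have e1 := (continuousAt_scaledChart (n := n) R h₁) (Metric.ball_mem_nhds _ hδ)
  have e2 : ∀ᶠ z in 𝓝 z₁, z.proj ∈ (extChartAt (𝓡 n) x₀).source :=
    (FiberBundle.continuous_proj (Covector n)
      (fun x : M => TangentSpace (𝓡 n) x →L[ℝ] ℝ)).continuousAt.eventually_mem
      ((isOpen_extChartAt_source x₀).mem_nhds h₁)
  filter_upwards [e1, e2] with z hz1 hz2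
  obtain ⟨y', hy', hr⟩ := hδ' (scaledChart x₀ R z) (by
    rw [← dist_eq_norm]; exact hz1)
  rw [symm_scaledChart hR hz2] at hr
  exact ⟨_, hr, hεN (by rw [Metric.mem_ball, dist_eq_norm]; exact hy')⟩

variable [IsContMDiffRiemannianBundle (𝓡 n) ∞ (EuclideanSpace ℝ (Fin n))
      (fun x : M => TangentSpace (𝓡 n) x)]

/-- Around every point the coordinate form of the system is valid, with uniform bounds, on a ball.
The vector `c` is the direction of the controls that are going to be used. -/
lemma exists_fieldBounds_hamilton (hV : ContMDiff (𝓡 n) 𝓘(ℝ, ℝ) 2 V)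
    (hW : ∀ i, ContMDiff (𝓡 n) 𝓘(ℝ, ℝ) 2 (W i)) (x₀ : M) (c : Fin n → ℝ) :
    ∃ (f : Phase n → Model n) (k : Phase n → Covector n),
      (∃ A : Covector n ≃L[ℝ] Model n, HasStrictFDerivAt f
        ((A : Covector n →L[ℝ] Model n) ∘L ContinuousLinearMap.snd ℝ _ _)
        (extChartAt (𝓡 n) x₀ x₀, 0)) ∧
      (∀ q, f (q, 0) = 0) ∧
      (∀ q (R : ℝ) η, f (q, R • η) = R • f (q, η)) ∧
      (∀ q (R : ℝ) η, k (q, R • η) = R ^ 2 • k (q, η)) ∧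
      ∃ a > 0, ∃ C : ℝ≥0,
        IsHamiltonCoordOn V W x₀ f k (Metric.closedBall (extChartAt (𝓡 n) x₀ x₀) a) ∧
        FieldBounds f k (fun q => -fderiv ℝ (V ∘ (extChartAt (𝓡 n) x₀).symm) q)
          (fun q => -∑ i, c i • fderiv ℝ (W i ∘ (extChartAt (𝓡 n) x₀).symm) q)
          (extChartAt (𝓡 n) x₀ x₀, (0 : Covector n)) a C := by
  obtain ⟨f, k, hf, hk, hA, hf0, hfR, hkR, hH⟩ := exists_hamilton_coord (n := n) x₀ hV hW
  refine ⟨f, k, hA, hf0, hfR, hkR, ?_⟩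
  have hVc : ContDiffAt ℝ 1 (fderiv ℝ (V ∘ (extChartAt (𝓡 n) x₀).symm))
      (extChartAt (𝓡 n) x₀ x₀) :=
    (contDiffAt_comp_extChartAt_symm (hV x₀)).fderiv_right (by norm_num)
  have hWc : ∀ i, ContDiffAt ℝ 1 (fderiv ℝ (W i ∘ (extChartAt (𝓡 n) x₀).symm))
      (extChartAt (𝓡 n) x₀ x₀) := fun i =>
    (contDiffAt_comp_extChartAt_symm (hW i x₀)).fderiv_right (by norm_num)
  obtain ⟨C, a, ha, hC⟩ := exists_fieldBounds (hf 0) (hk 0) hVc.neg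
    (ContDiffAt.sum fun i (_ : i ∈ Finset.univ) => (hWc i).const_smul (c i)).neg
  obtain ⟨b, hb, hbH⟩ := Metric.nhds_basis_closedBall.mem_iff.1 hH
  exact ⟨min a b, lt_min ha hb, C,
    fun q hq => hbH (Metric.closedBall_subset_closedBall (min_le_right _ _) hq),
    hC.mono (min_le_left _ _)⟩

/-- Off the degeneracy set, a strong control acting for a short time changes the covector
arbitrarily while the base point hardly moves. -/
lemma steers_of_proj_eq (hV : ContMDiff (𝓡 n) 𝓘(ℝ, ℝ) 2 V)
    (hW : ∀ i, ContMDiff (𝓡 n) 𝓘(ℝ, ℝ) 2 (W i)) {z z' : CotangentBundle n M}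
    (hzz' : z'.proj = z.proj) (hz : z.proj ∉ degeneracySet W) {T : ℝ} (hT : 0 < T) :
    Steers V W T z z' := by
  set x₀ := z.proj with hx₀
  set q₀ := extChartAt (𝓡 n) x₀ x₀ with hq₀
  set ξ := (cotangentChart x₀ z).2 with hξ
  set ξ' := (cotangentChart x₀ z').2 with hξ'
  obtain ⟨c, hc⟩ := exists_sum_smul_fderiv_eq hW hz (ξ - ξ')
  obtain ⟨f, k, -, -, hfR, hkR, a, ha, C, hH, hC⟩ := exists_fieldBounds_hamilton hV hW x₀ c
  rw [← hq₀] at hH hC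
  set w : Model n → Covector n :=
    fun q => -∑ i, c i • fderiv ℝ (W i ∘ (extChartAt (𝓡 n) x₀).symm) q with hw
  have hwq : w q₀ = ξ' - ξ := by rw [hw]; simp only; rw [hc, neg_sub]
  -- the momenta are scaled down so much that the kick remains in the ball of radius `a`
  obtain ⟨R, hR1, hR2, hR3⟩ : ∃ R : ℝ, 0 < R ∧ ‖ξ‖ / R < a / 4 ∧ C / R < a / 4 := by
    have h1 : Filter.Tendsto (fun R : ℝ => ‖ξ‖ / R) Filter.atTop (𝓝 0) :=
      Filter.Tendsto.const_div_atTop Filter.tendsto_id _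
    have h2 : Filter.Tendsto (fun R : ℝ => (C : ℝ) / R) Filter.atTop (𝓝 0) :=
      Filter.Tendsto.const_div_atTop Filter.tendsto_id _
    have ha4 : (0 : ℝ) < a / 4 := by positivity
    obtain ⟨R, hR⟩ := ((Filter.eventually_gt_atTop (0 : ℝ)).and ((h1.eventually_lt_const ha4).and
      (h2.eventually_lt_const ha4))).exists
    exact ⟨R, hR⟩
  have hfst : ∀ y : CotangentBundle n M,
      (cotangentChart x₀ y).1 = extChartAt (𝓡 n) x₀ y.proj := fun y => by
    rw [cotangentChart_apply]
  have hS : scaledChart x₀ R z = (q₀, R⁻¹ • ξ) := by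
    exact Prod.ext (hfst z) rfl
  have hS' : scaledChart x₀ R z' = (q₀, R⁻¹ • ξ') := by
    refine Prod.ext (hfst z' |>.trans ?_) rfl
    simp only [hzz', hq₀]
  refine steers_of_scaledChart (x₀ := x₀) hR1.ne' (mem_extChartAt_source _)
    (by rw [hzz']; exact mem_extChartAt_source _) fun ε hε => ?_
  rw [hS, hS']
  -- the error of the kick tends to zero with its duration `r` and with the initial error `r`
  obtain ⟨r, hr, hrT, hra, hrs, hrε⟩ : ∃ r : ℝ, 0 < r ∧ r < T ∧ r < a / 4 ∧
      (r * R + r / R) * C < a / 4 ∧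
      r + (r * R + r / R) * C + R⁻¹ * (C * (r + r * R * C)) < ε := by
    have h1 : ContinuousAt (fun r : ℝ => (r * R + r / R) * C) 0 := by fun_prop
    have h2 : ContinuousAt (fun r : ℝ => r + (r * R + r / R) * C +
      R⁻¹ * (C * (r + r * R * C))) 0 := by fun_prop
    have e1 := h1.eventually_lt_const (u := a / 4) (by simp; exact ha)
    have e2 := h2.eventually_lt_const (u := ε) (by simp; exact hε)
    have e3 : ∀ᶠ r : ℝ in 𝓝 0, r < T ∧ r < a / 4 :=
      (eventually_lt_nhds hT).and (eventually_lt_nhds (by positivity))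
    have e4 := (e1.and (e2.and e3)).filter_mono (nhdsWithin_le_nhds (s := Ioi 0))
    obtain ⟨r, ⟨h1, h2, h3, h4⟩, h5⟩ := (e4.and self_mem_nhdsWithin).exists
    exact ⟨r, h5, h3, h4, h1, h2⟩
  -- the control `c / r` acts during time `r`: `γ = R⁻¹` stays fixed while `α, β` tend to zero
  refine ⟨r, hr, fun y hy => ?_⟩
  have hα : 0 ≤ r * R := by positivity
  have hβ : 0 ≤ r / R := by positivity
  have hγ : 0 ≤ R⁻¹ := by positivity
  have hya : y ∈ Metric.closedBall (q₀, (0 : Covector n)) (a / 2) := by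
    rw [mem_closedBall_iff_norm]
    have h1 : ‖((0 : Model n), R⁻¹ • ξ)‖ < a / 4 := by
      rw [Prod.norm_mk, norm_zero, norm_smul, norm_inv, Real.norm_of_nonneg hR1.le]
      rw [div_eq_inv_mul] at hR2
      exact max_lt (by positivity) hR2
    have h2 : y - (q₀, (0 : Covector n)) = (y - (q₀, R⁻¹ • ξ)) + ((0 : Model n), R⁻¹ • ξ) := by
      ext1 <;> simp
    rw [h2]
    linarith [norm_add_le (y - (q₀, R⁻¹ • ξ)) ((0 : Model n), R⁻¹ • ξ)]
  obtain ⟨ζ, hζ⟩ := hC.exists_isTrajectory ha.le hα hβ hγ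
    (by rw [div_eq_inv_mul] at hR3; rw [add_mul]; linarith) hya
  refine ⟨ζ 1, ?_, hζ.mem_classicalReachableSet hH hfR hkR hr hR1 hrT.le c⟩
  have hk := hC.dist_kick_le hα hβ hγ (R⁻¹ • ξ) ha.le hζ
  have e : R⁻¹ • ξ + R⁻¹ • w (q₀, (0 : Covector n)).1 = R⁻¹ • ξ' := by
    simp only
    rw [hwq, ← smul_add, add_sub_cancel]
  rw [e] at hk
  refine (hk.trans ?_).trans_lt hrε
  have hy' := hy.le
  gcongr

/-- Nearby base points can be joined, in arbitrarily short time, by fast geodesics. -/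
lemma exists_open_steers (hV : ContMDiff (𝓡 n) 𝓘(ℝ, ℝ) 2 V)
    (hW : ∀ i, ContMDiff (𝓡 n) 𝓘(ℝ, ℝ) 2 (W i)) (x₀ : M) :
    ∃ U : Set M, IsOpen U ∧ x₀ ∈ U ∧ ∀ x ∈ U, ∀ y ∈ U, ∀ T : ℝ, 0 < T →
      ∃ z z' : CotangentBundle n M, z.proj = x ∧ z'.proj = y ∧ Steers V W T z z' := by
  obtain ⟨f, k, ⟨A, hA⟩, hf0, hfR, hkR, a, ha, C, hH, hC⟩ :=
    exists_fieldBounds_hamilton hV hW x₀ 0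
  set q₀ := extChartAt (𝓡 n) x₀ x₀ with hq₀
  obtain ⟨b, hb, hba, α, hα, ε, hε, hs1, hs2, hit⟩ := exists_trajectory_hits hC ha hA hf0
  have hCb := hC.mono hba
  refine ⟨(extChartAt (𝓡 n) x₀).source ∩ extChartAt (𝓡 n) x₀ ⁻¹' Metric.ball q₀ ε,
    (continuousOn_extChartAt x₀).isOpen_inter_preimage (isOpen_extChartAt_source x₀)
      Metric.isOpen_ball, ⟨mem_extChartAt_source x₀, Metric.mem_ball_self hε⟩, ?_⟩
  rintro x ⟨hxs, hxε⟩ y ⟨hys, hyε⟩ T hT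
  obtain ⟨R, hR, hR1, hRT⟩ : ∃ R : ℝ, 0 < R ∧ 1 ≤ R ∧ α / R ≤ T := by
    refine ⟨max 1 (α / T), by positivity, le_max_left _ _, ?_⟩
    rw [div_le_iff₀ (by positivity), mul_comm, ← div_le_iff₀ hT]
    exact le_max_right _ _
  -- the initial momentum is `R η`, the duration `τ = α / R`, so that `τ R = α` is the fixed `α` of
  -- `exists_trajectory_hits` and the potential is weighted by `τ / R ≤ α`
  have hτ : 0 < α / R := by positivity
  have hβ0 : 0 ≤ α / R / R := by positivity
  have hβ : α / R / R ≤ α := (div_le_self hτ.le hR1).trans (div_le_self hα.le hR1)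
  have hsum : (α + α / R / R + 0) * C ≤ (α + α + 0) * C := by gcongr
  obtain ⟨hball, η, hη, ζ, hζ, hζ1⟩ := hit _ hβ0 hβ _ (Metric.ball_subset_closedBall hxε) _
    (Metric.ball_subset_closedBall hyε)
  have hproj : ∀ q ∈ (extChartAt (𝓡 n) x₀).target, ∀ ξ : Covector n,
      ((cotangentChart x₀).symm (q, ξ)).proj = (extChartAt (𝓡 n) x₀).symm q := fun q hq ξ => by
    rw [cotangentChart_symm_apply hq]
  have hx := hproj _ ((extChartAt (𝓡 n) x₀).map_source hxs)
  have hy := hproj _ ((extChartAt (𝓡 n) x₀).map_source hys)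
  rw [(extChartAt (𝓡 n) x₀).left_inv hxs] at hx
  rw [(extChartAt (𝓡 n) x₀).left_inv hys] at hy
  have hchart : ∀ q ∈ (extChartAt (𝓡 n) x₀).target, ∀ η : Covector n,
      scaledChart x₀ R ((cotangentChart x₀).symm (q, R • η)) = (q, η) := fun q hq η => by
    have : (q, R • η) ∈ (cotangentChart (n := n) x₀).target := by
      rw [cotangentChart_target]; exact ⟨hq, mem_univ _⟩
    rw [scaledChart, (cotangentChart x₀).right_inv this]
    simp [inv_smul_smul₀ hR.ne']
  refine ⟨_, _, hx (R • η), hy (R • (ζ 1).2), steers_of_scaledChart (x₀ := x₀) hR.ne'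
    (by rwa [hx]) (by rwa [hy]) fun δ hδ => ?_⟩
  rw [hchart _ ((extChartAt (𝓡 n) x₀).map_source hxs),
    hchart _ ((extChartAt (𝓡 n) x₀).map_source hys)]
  refine ⟨min (b / 4) (δ / 3), by positivity, fun p hp => ?_⟩
  have hp1 := lt_min_iff.1 hp
  have hpb : p ∈ Metric.closedBall (q₀, (0 : Covector n)) (b / 2) := by
    have h1 := mem_closedBall_iff_norm.1 (hball η hη)
    rw [mem_closedBall_iff_norm]
    have h2 := norm_sub_le_norm_sub_add_norm_sub p (extChartAt (𝓡 n) x₀ x, η)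
      (q₀, (0 : Covector n))
    linarith
  obtain ⟨ζ', hζ'⟩ := hCb.exists_isTrajectory hb.le hα.le hβ0 le_rfl (hsum.trans hs1) hpb
  refine ⟨ζ' 1, ?_, ?_⟩
  · have h1 := hCb.dist_trajectory_le hα.le hβ0 le_rfl (hsum.trans hs2) hζ' hζ
      (right_mem_Icc.2 zero_le_one)
    rw [← hζ1, Prod.mk.eta]
    linarith
  · have hαR : α = α / R * R := by field_simp
    rw [show scaledField f k _ _ α (α / R / R) 0 = scaledField f k _ _ (α / R * R) (α / R / R) 0
      by rw [← hαR]] at hζ'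
    refine IsTrajectory.mem_classicalReachableSet (fun q hq => hH q ?_) hfR hkR hτ hR hRT 0 hζ'
    exact Metric.closedBall_subset_closedBall hba hq

end Steering

/-! ### Sufficiency: propagation along the connected manifold -/

section Sufficiency

variable {n : ℕ} {M : Type*} [TopologicalSpace M] [ChartedSpace (EuclideanSpace ℝ (Fin n)) M]
  [IsManifold (𝓡 n) ∞ M] [RiemannianBundle (fun x : M => TangentSpace (𝓡 n) x)]
  [IsContMDiffRiemannianBundle (𝓡 n) ∞ (EuclideanSpace ℝ (Fin n))
      (fun x : M => TangentSpace (𝓡 n) x)]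
  {V : M → ℝ} {W : Fin n → M → ℝ}

/-- All pairs of states over nearby nondegenerate points can be steered to each other: the initial
and the final covector are adjusted by kicks, the base point is moved by a fast geodesic. -/
lemma exists_open_steers_of_notMem (hV : ContMDiff (𝓡 n) 𝓘(ℝ, ℝ) 2 V)
    (hW : ∀ i, ContMDiff (𝓡 n) 𝓘(ℝ, ℝ) 2 (W i)) (x₀ : M) :
    ∃ U : Set M, IsOpen U ∧ x₀ ∈ U ∧ ∀ z z' : CotangentBundle n M, z.proj ∈ U → z'.proj ∈ U →
      z.proj ∉ degeneracySet W → z'.proj ∉ degeneracySet W → ∀ T : ℝ, 0 < T →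
        Steers V W T z z' := by
  obtain ⟨U, hU, hxU, h⟩ := exists_open_steers hV hW x₀
  refine ⟨U, hU, hxU, fun z z' hz hz' hzO hzO' T hT => ?_⟩
  have hT3 : 0 < T / 3 := by positivity
  obtain ⟨y, y', hy, hy', hs⟩ := h _ hz _ hz' _ hT3
  have h1 := ((steers_of_proj_eq hV hW hy hzO hT3).trans hs).trans
    (steers_of_proj_eq hV hW hy'.symm (by rwa [hy']) hT3)
  convert h1 using 1
  ring

/-- On a connected manifold, if the degeneracy set has empty interior, all pairs of states over
nondegenerate points can be steered to each other in arbitrarily short time. -/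
lemma steers_of_notMem [ConnectedSpace M] (hV : ContMDiff (𝓡 n) 𝓘(ℝ, ℝ) 2 V)
    (hW : ∀ i, ContMDiff (𝓡 n) 𝓘(ℝ, ℝ) 2 (W i)) (hO : interior (degeneracySet W) = ∅)
    {z z' : CotangentBundle n M} (hz : z.proj ∉ degeneracySet W)
    (hz' : z'.proj ∉ degeneracySet W) {T : ℝ} (hT : 0 < T) : Steers V W T z z' := by
  have hdense : Dense (degeneracySet W)ᶜ := interior_eq_empty_iff_dense_compl.1 hO
  set S : Set M := {m | ∃ U : Set M, IsOpen U ∧ m ∈ U ∧ ∀ y : CotangentBundle n M, y.proj ∈ U →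
    y.proj ∉ degeneracySet W → ∀ T : ℝ, 0 < T → Steers V W T z y} with hS
  have hopen : IsOpen S := isOpen_iff_mem_nhds.2 fun m ⟨U, hU, hmU, h⟩ =>
    Filter.mem_of_superset (hU.mem_nhds hmU) fun m' hm' => ⟨U, hU, hm', h⟩
  have hclosed : IsClosed S := by
    refine isClosed_of_closure_subset fun m hm => ?_
    obtain ⟨U, hU, hmU, h⟩ := exists_open_steers_of_notMem hV hW m
    obtain ⟨m', hm'U, U', hU', hm'U', h'⟩ := mem_closure_iff.1 hm U hU hmU
    obtain ⟨x, ⟨hxU, hxU'⟩, hxO⟩ := hdense.inter_open_nonempty (U ∩ U') (hU.inter hU')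
      ⟨m', hm'U, hm'U'⟩
    refine ⟨U, hU, hmU, fun y hy hyO T hT => ?_⟩
    have hT2 : 0 < T / 2 := by positivity
    have h1 := (h' ⟨x, 0⟩ hxU' hxO _ hT2).trans (h ⟨x, 0⟩ y hxU hy hxO hyO _ hT2)
    rwa [add_halves] at h1
  have hne : S.Nonempty := by
    obtain ⟨U, hU, hzU, h⟩ := exists_open_steers_of_notMem hV hW z.proj
    exact ⟨z.proj, U, hU, hzU, fun y hy hyO T hT => h z y hzU hy hz hyO T hT⟩
  have huniv := IsClopen.eq_univ ⟨hclosed, hopen⟩ hne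
  obtain ⟨U, -, hU, h⟩ : z'.proj ∈ S := by rw [huniv]; trivial
  exact h z' hU hz' T hT

theorem isSmallTimeCAControllable_of_interior_eq_empty [ConnectedSpace M]
    (hV : ContMDiff (𝓡 n) 𝓘(ℝ, ℝ) 2 V) (hW : ∀ i, ContMDiff (𝓡 n) 𝓘(ℝ, ℝ) 2 (W i))
    (hO : interior (degeneracySet W) = ∅) : IsSmallTimeCAControllable V W := by
  have hdense : Dense ((TotalSpace.proj : CotangentBundle n M → M) ⁻¹' (degeneracySet W)ᶜ) :=
    (interior_eq_empty_iff_dense_compl.1 hO).preimage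
      (FiberBundle.isOpenMap_proj (Covector n) (fun x : M => TangentSpace (𝓡 n) x →L[ℝ] ℝ))
  refine le_antisymm (le_of_forall_gt fun τ hτ => ?_) bot_le
  obtain ⟨T, hT0, hTτ⟩ := ENNReal.lt_iff_exists_nnreal_btwn.1 hτ
  refine lt_of_le_of_lt (sInf_le ⟨T, rfl, _, hdense, fun z hz => ?_⟩) hTτ
  have h := (hdense.mono fun z' hz' => (steers_of_notMem hV hW hO hz hz'
    (T := T) (by exact_mod_cast hT0)).mem_closure).closure_eq
  rwa [closure_closure] at h

end Sufficiency

/-! ### Necessity: speed bound where the control has no effect -/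

section Necessity

/-- Mean value inequality on a short interval to the right of `t`, for a curve that need not be
differentiable at `t` itself. -/
lemma norm_sub_le_of_hasDerivAt_Ioo {F : Type*} [NormedAddCommGroup F] [NormedSpace ℝ F]
    {g d : ℝ → F} {t u L : ℝ} (hc : ContinuousWithinAt g (Ioi t) t)
    (hd : ∀ r ∈ Ioo t u, HasDerivAt g (d r) r) (hL : ∀ r ∈ Ioo t u, ‖d r‖ ≤ L) {r : ℝ}
    (hr : r ∈ Ioo t u) : ‖g r - g t‖ ≤ L * (r - t) := by
  have h1 : ∀ᶠ r' in 𝓝[>] t, ‖g r - g r'‖ ≤ L * (r - r') := by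
    filter_upwards [Ioo_mem_nhdsGT hr.1] with r' hr'
    have hsub : Icc r' r ⊆ Ioo t u := fun x hx => ⟨hr'.1.trans_le hx.1, hx.2.trans_lt hr.2⟩
    have h2 := (convex_Icc r' r).norm_image_sub_le_of_norm_hasDerivWithin_le
      (fun x hx => (hd x (hsub hx)).hasDerivWithinAt) (fun x hx => hL x (hsub hx))
      (left_mem_Icc.2 hr'.2.le) (right_mem_Icc.2 hr'.2.le)
    rwa [Real.norm_of_nonneg (by linarith [hr'.2])] at h2
  have h2 : Filter.Tendsto (fun r' => ‖g r - g r'‖) (𝓝[>] t) (𝓝 ‖g r - g t‖) :=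
    (tendsto_const_nhds.sub hc).norm
  have h3 : Filter.Tendsto (fun r' => L * (r - r')) (𝓝[>] t) (𝓝 (L * (r - t))) := by
    have : Continuous fun r' : ℝ => L * (r - r') := by fun_prop
    exact this.continuousWithinAt
  exact le_of_tendsto_of_tendsto h2 h3 h1

variable {n : ℕ} {M : Type*} [TopologicalSpace M] [ChartedSpace (EuclideanSpace ℝ (Fin n)) M]
  [IsManifold (𝓡 n) ∞ M]

/-- The states over the chart domain with coordinates in the closed ball of radius `b` around
`(q₀, 0)`, where `q₀` are the coordinates of `x₀`. -/
def chartBox (x₀ : M) (b : ℝ) : Set (CotangentBundle n M) :=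
  {z | z.proj ∈ (extChartAt (𝓡 n) x₀).source ∧
    cotangentChart x₀ z ∈ Metric.closedBall (extChartAt (𝓡 n) x₀ x₀, (0 : Covector n)) b}

lemma isClosed_chartBox [T2Space M] {x₀ : M} {b : ℝ}
    (hb : Metric.closedBall (extChartAt (𝓡 n) x₀ x₀) b ⊆ (extChartAt (𝓡 n) x₀).target) :
    IsClosed (chartBox (n := n) x₀ b) := by
  set B : Set M := (extChartAt (𝓡 n) x₀).symm '' Metric.closedBall (extChartAt (𝓡 n) x₀ x₀) b
  have hB : IsClosed B := ((isCompact_closedBall _ _).image_of_continuousOn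
    ((continuousOn_extChartAt_symm x₀).mono hb)).isClosed
  have hBs : B ⊆ (extChartAt (𝓡 n) x₀).source := by
    rintro _ ⟨q, hq, rfl⟩
    exact (extChartAt (𝓡 n) x₀).map_target (hb hq)
  have hpre : IsClosed ((TotalSpace.proj : CotangentBundle n M → M) ⁻¹' B) :=
    hB.preimage (FiberBundle.continuous_proj (Covector n)
      (fun x : M => TangentSpace (𝓡 n) x →L[ℝ] ℝ))
  have hc : ContinuousOn (cotangentChart (n := n) x₀)
      ((TotalSpace.proj : CotangentBundle n M → M) ⁻¹' B) := fun z hz =>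
    (mdifferentiableAt_cotangentChart (hBs hz)).continuousAt.continuousWithinAt
  convert hc.preimage_isClosed_of_isClosed hpre
    (Metric.isClosed_closedBall (x := (extChartAt (𝓡 n) x₀ x₀, (0 : Covector n))) (ε := b)) using 1
  ext z
  refine ⟨fun hz => ⟨⟨extChartAt (𝓡 n) x₀ z.proj, ?_, (extChartAt (𝓡 n) x₀).left_inv hz.1⟩, hz.2⟩,
    fun hz => ⟨hBs hz.1, hz.2⟩⟩
  have h := hz.2
  rw [← closedBall_prod_same] at h
  have h1 := h.1
  rwa [cotangentChart_apply] at h1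

lemma chartBox_mem_nhds {x₀ : M} {b b' : ℝ} (hb : b < b') {z : CotangentBundle n M}
    (hz : z ∈ chartBox x₀ b) : chartBox x₀ b' ∈ 𝓝 z := by
  have e1 := (mdifferentiableAt_cotangentChart hz.1).continuousAt.eventually_mem
    (Metric.closedBall_mem_nhds_of_mem
      ((Metric.closedBall_subset_ball hb) hz.2))
  have e2 : ∀ᶠ z' in 𝓝 z, z'.proj ∈ (extChartAt (𝓡 n) x₀).source :=
    (FiberBundle.continuous_proj (Covector n)
      (fun x : M => TangentSpace (𝓡 n) x →L[ℝ] ℝ)).continuousAt.eventually_mem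
      ((isOpen_extChartAt_source x₀).mem_nhds hz.1)
  filter_upwards [e1, e2] with z' h1 h2 using ⟨h2, h1⟩

lemma zero_mem_chartBox (x₀ : M) {b : ℝ} (hb : 0 ≤ b) :
    (⟨x₀, 0⟩ : CotangentBundle n M) ∈ chartBox x₀ b := by
  refine ⟨mem_extChartAt_source x₀, ?_⟩
  rw [cotangentChart_apply]
  simpa using hb

lemma chartBox_ne_univ (hn : 0 < n) (x₀ : M) (b : ℝ) : chartBox (n := n) x₀ b ≠ univ := by
  have : Nontrivial (Covector n) :=
    Module.nontrivial_of_finrank_pos (R := ℝ) (by rwa [finrank_covector])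
  obtain ⟨ξ, hξ⟩ := NormedSpace.exists_lt_norm ℝ (Covector n) b
  intro h
  have hq := mem_extChartAt_target (I := 𝓡 n) x₀
  have hmem : (cotangentChart x₀).symm (extChartAt (𝓡 n) x₀ x₀, ξ) ∈ chartBox (n := n) x₀ b := by
    rw [h]; trivial
  have h2 := hmem.2
  rw [(cotangentChart x₀).right_inv (by rw [cotangentChart_target]; exact ⟨hq, mem_univ _⟩),
    ← closedBall_prod_same] at h2
  have h3 := h2.2
  rw [mem_closedBall_zero_iff] at h3
  exact absurd h3 (not_le.2 hξ)

lemma fderiv_comp_extChartAt_symm_eq_zero {h : M → ℝ} {x₀ : M} {q : Model n}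
    (hq : q ∈ (extChartAt (𝓡 n) x₀).target)
    (hh : MDifferentiableAt (𝓡 n) 𝓘(ℝ, ℝ) h ((extChartAt (𝓡 n) x₀).symm q))
    (h0 : mvfderiv (𝓡 n) h ((extChartAt (𝓡 n) x₀).symm q) = 0) :
    fderiv ℝ (h ∘ (extChartAt (𝓡 n) x₀).symm) q = 0 := by
  have hd : MDifferentiableAt 𝓘(ℝ, Model n) (𝓡 n) (extChartAt (𝓡 n) x₀).symm q := by
    have := mdifferentiableWithinAt_extChartAt_symm (I := 𝓡 n) hq
    rwa [ModelWithCorners.range_eq_univ, mdifferentiableWithinAt_univ] at this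
  obtain ⟨Y, hY⟩ : ∃ Y : Model n →L[ℝ] Model n,
      HasMFDerivAt 𝓘(ℝ, Model n) (𝓡 n) (extChartAt (𝓡 n) x₀).symm q Y := ⟨_, hd.hasMFDerivAt⟩
  have hh' : HasMFDerivAt (𝓡 n) 𝓘(ℝ, ℝ) h ((extChartAt (𝓡 n) x₀).symm q)
      (0 : Model n →L[ℝ] ℝ) :=
    hh.hasMFDerivAt.congr_mfderiv (ContinuousLinearMap.ext fun v => DFunLike.congr_fun h0 v)
  have h1 : HasFDerivAt (h ∘ (extChartAt (𝓡 n) x₀).symm) ((0 : Model n →L[ℝ] ℝ) ∘L Y) q :=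
    (HasMFDerivAt.comp q hh' hY).hasFDerivAt
  rw [h1.fderiv, ContinuousLinearMap.zero_comp]

variable [RiemannianBundle (fun x : M => TangentSpace (𝓡 n) x)]
  {V : M → ℝ} {W : Fin n → M → ℝ}

/-- Where the control has no effect, states reachable in short time stay in a fixed box. -/
lemma classicalReachableSet_subset_chartBox [T2Space M] {x₀ : M} {f : Phase n → Model n}
    {k : Phase n → Covector n} {a L T : ℝ} (ha : 0 < a)
    (hB : IsHamiltonCoordOn V W x₀ f k (Metric.closedBall (extChartAt (𝓡 n) x₀ x₀) a))
    (hL : ∀ y ∈ Metric.closedBall (extChartAt (𝓡 n) x₀ x₀, (0 : Covector n)) a,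
      ‖(f y, k y - fderiv ℝ (V ∘ (extChartAt (𝓡 n) x₀).symm) y.1)‖ ≤ L)
    (hW : ∀ q ∈ Metric.closedBall (extChartAt (𝓡 n) x₀ x₀) a, ∀ i,
      fderiv ℝ (W i ∘ (extChartAt (𝓡 n) x₀).symm) q = 0)
    (hT : L * T ≤ a / 4) {z₀ : CotangentBundle n M} (hz₀ : z₀ ∈ chartBox x₀ (a / 4)) :
    classicalReachableSet V W T z₀ ⊆ chartBox x₀ (a / 2) := by
  rintro _ ⟨s, hs, hsT, u, -, z, ⟨hzc, F, hF⟩, rfl, rfl⟩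
  set q₀ := extChartAt (𝓡 n) x₀ x₀ with hq₀
  have hL0 : 0 ≤ L := (norm_nonneg _).trans (hL _ (Metric.mem_closedBall_self ha.le))
  have hK : IsClosed (chartBox (n := n) x₀ (a / 2)) := isClosed_chartBox fun q hq =>
    (hB q (Metric.closedBall_subset_closedBall (by linarith) hq)).1
  have hfst : ∀ {y : Phase n}, y ∈ Metric.closedBall (q₀, (0 : Covector n)) a →
      y.1 ∈ Metric.closedBall q₀ a := fun {y} hy => by
    rw [← closedBall_prod_same] at hy; exact hy.1
  -- the control drops out of the equation, so the speed is at most `L`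
  have hderiv : ∀ t ∈ Ioo 0 s \ (F : Set ℝ), z t ∈ chartBox x₀ a → ∃ d : Phase n, ‖d‖ ≤ L ∧
      HasDerivAt (cotangentChart x₀ ∘ z) d t := by
    intro t ht hzt
    obtain ⟨hd, hv⟩ := (hB _ (hfst hzt.2)).2 (u t) (cotangentChart x₀ (z t)).2
    refine ⟨_, ?_, hasDerivAt_cotangentChart_comp (hF t ht) hzt.1 hd⟩
    rw [Prod.mk.eta] at hv
    have hsum : ∑ i, u t i • fderiv ℝ (W i ∘ (extChartAt (𝓡 n) x₀).symm)
        (cotangentChart x₀ (z t)).1 = 0 :=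
      Finset.sum_eq_zero fun i _ => by rw [hW _ (hfst hzt.2) i, smul_zero]
    rw [hv, hsum, sub_zero]
    exact hL _ hzt.2
  -- continuous induction on the property that the box is not left and the speed bound holds
  set A : Set ℝ := {t | z t ∈ chartBox x₀ (a / 2) ∧
    ‖cotangentChart x₀ (z t) - cotangentChart x₀ (z 0)‖ ≤ L * t} with hA
  have hAc : IsClosed (A ∩ Icc 0 s) := by
    have h1 : IsClosed (Icc 0 s ∩ z ⁻¹' chartBox x₀ (a / 2)) :=
      hzc.preimage_isClosed_of_isClosed isClosed_Icc hK
    have h2 : ContinuousOn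
        (fun t => ‖cotangentChart x₀ (z t) - cotangentChart x₀ (z 0)‖ - L * t)
        (Icc 0 s ∩ z ⁻¹' chartBox x₀ (a / 2)) := by
      have h3 : ContinuousOn (fun t => cotangentChart x₀ (z t))
          (Icc 0 s ∩ z ⁻¹' chartBox x₀ (a / 2)) := fun t ht =>
        (mdifferentiableAt_cotangentChart ht.2.1).continuousAt.comp_continuousWithinAt
          ((hzc t ht.1).mono inter_subset_left)
      exact ((h3.sub continuousOn_const).norm).sub (by fun_prop)
    convert h2.preimage_isClosed_of_isClosed h1 (isClosed_Iic (a := (0 : ℝ))) using 1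
    ext t
    simp only [hA, mem_inter_iff, mem_ofPred_eq, mem_preimage, mem_Iic, sub_nonpos]
    tauto
  have hA0 : (0 : ℝ) ∈ A := by
    refine ⟨⟨hz₀.1, Metric.closedBall_subset_closedBall (by linarith) hz₀.2⟩, by simp⟩
  refine (IsClosed.Icc_subset_of_forall_exists_gt hAc hA0 ?_ (right_mem_Icc.2 hs)).1
  rintro t ⟨⟨htK, htL⟩, ht0, hts⟩ y hy
  have hzt : ContinuousWithinAt z (Ioi t) t :=
    (hzc t ⟨ht0, hts.le⟩).mono_of_mem_nhdsWithin
      (Filter.mem_of_superset (Ioo_mem_nhdsGT hts) fun r hr => ⟨ht0.trans hr.1.le, hr.2.le⟩)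
  have e1 : ∀ᶠ r in 𝓝[>] t, z r ∈ chartBox x₀ a := hzt (chartBox_mem_nhds (by linarith) htK)
  have e2 : ∀ᶠ r in 𝓝[>] t, r ∉ (F : Set ℝ) := by
    have h1 : ((F : Set ℝ) \ {t})ᶜ ∈ 𝓝 t :=
      (F.finite_toSet.sdiff.isClosed.isOpen_compl).mem_nhds (by simp)
    filter_upwards [nhdsWithin_le_nhds h1, self_mem_nhdsWithin] with r hr hr' hrF
    exact hr ⟨hrF, ne_of_gt hr'⟩
  obtain ⟨v, hv, hvI⟩ := mem_nhdsGT_iff_exists_Ioo_subset.1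
    (e1.and (e2.and ((Ioo_mem_nhdsGT hts : ∀ᶠ r in 𝓝[>] t, r ∈ Ioo t s))))
  obtain ⟨r, hr1, hr2⟩ := exists_between (lt_min (show t < v from hv) (show t < y from hy))
  have hrv : r ∈ Ioo t v := ⟨hr1, hr2.trans_le (min_le_left _ _)⟩
  have hd : ∀ r ∈ Ioo t v, ∃ d : Phase n, ‖d‖ ≤ L ∧ HasDerivAt (cotangentChart x₀ ∘ z) d r :=
    fun r hr => hderiv r ⟨⟨ht0.trans_lt hr.1, (hvI hr).2.2.2⟩, (hvI hr).2.1⟩ (hvI hr).1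
  choose! d hdL hdd using hd
  have hstep := norm_sub_le_of_hasDerivAt_Ioo (g := cotangentChart x₀ ∘ z)
    ((mdifferentiableAt_cotangentChart htK.1).continuousAt.comp_continuousWithinAt hzt)
    hdd hdL hrv
  have hrs : r < s := (hvI hrv).2.2.2
  have hrL : ‖cotangentChart x₀ (z r) - cotangentChart x₀ (z 0)‖ ≤ L * r := by
    have := norm_sub_le_norm_sub_add_norm_sub (cotangentChart x₀ (z r)) (cotangentChart x₀ (z t))
      (cotangentChart x₀ (z 0))
    simp only [Function.comp_apply] at hstep
    linarith
  refine ⟨r, ⟨⟨(hvI hrv).1.1, ?_⟩, hrL⟩, hr1, (hr2.trans_le (min_le_right _ _)).le⟩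
  have h0 := mem_closedBall_iff_norm.1 hz₀.2
  rw [mem_closedBall_iff_norm]
  have h1 := norm_sub_le_norm_sub_add_norm_sub (cotangentChart x₀ (z r)) (cotangentChart x₀ (z 0))
    (q₀, (0 : Covector n))
  have h2 : L * r ≤ L * T := by gcongr; linarith
  linarith

variable [IsContMDiffRiemannianBundle (𝓡 n) ∞ (EuclideanSpace ℝ (Fin n))
      (fun x : M => TangentSpace (𝓡 n) x)]

/-- If all the `dW_i` vanish near some point, the system is not small-time CA-controllable. -/
theorem not_isSmallTimeCAControllable [T2Space M] (hn : 0 < n)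
    (hV : ContMDiff (𝓡 n) 𝓘(ℝ, ℝ) 2 V) (hW : ∀ i, ContMDiff (𝓡 n) 𝓘(ℝ, ℝ) 2 (W i)) {x₀ : M}
    (h0 : ∀ᶠ x in 𝓝 x₀, ∀ i, mvfderiv (𝓡 n) (W i) x = 0) : ¬ IsSmallTimeCAControllable V W := by
  obtain ⟨f, k, -, -, -, -, a₁, ha₁, C, hH, hC⟩ := exists_fieldBounds_hamilton hV hW x₀ 0
  set q₀ := extChartAt (𝓡 n) x₀ x₀ with hq₀
  have h1 : ∀ᶠ q in 𝓝 q₀, ∀ i, mvfderiv (𝓡 n) (W i) ((extChartAt (𝓡 n) x₀).symm q) = 0 := by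
    have hc : ContinuousAt (extChartAt (𝓡 n) x₀).symm q₀ := continuousAt_extChartAt_symm x₀
    rw [ContinuousAt, hq₀, extChartAt_to_inv] at hc
    exact hc.eventually h0
  obtain ⟨a₂, ha₂, h2⟩ := Metric.nhds_basis_closedBall.mem_iff.1 h1
  set a := min a₁ a₂ with ha
  have ha0 : 0 < a := lt_min ha₁ ha₂
  have hB : IsHamiltonCoordOn V W x₀ f k (Metric.closedBall q₀ a) := fun q hq =>
    hH q (Metric.closedBall_subset_closedBall (min_le_left _ _) hq)
  have hC' := hC.mono (min_le_left a₁ a₂)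
  have hL : ∀ y ∈ Metric.closedBall (q₀, (0 : Covector n)) a,
      ‖(f y, k y - fderiv ℝ (V ∘ (extChartAt (𝓡 n) x₀).symm) y.1)‖ ≤ 2 * C := fun y hy => by
    have := hC'.norm_scaledField_le zero_le_one zero_le_one le_rfl hy
    simp only [scaledField, one_smul, zero_smul, add_zero, ← sub_eq_add_neg] at this
    linarith
  have hW0 : ∀ q ∈ Metric.closedBall q₀ a, ∀ i,
      fderiv ℝ (W i ∘ (extChartAt (𝓡 n) x₀).symm) q = 0 := fun q hq i =>
    fderiv_comp_extChartAt_symm_eq_zero (hB q hq).1 ((hW i).mdifferentiable (by norm_num) _)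
      (h2 (Metric.closedBall_subset_closedBall (min_le_right _ _) hq) i)
  set T₀ : ℝ≥0 := Real.toNNReal (a / (8 * (C + 1))) with hT₀
  have hT₀v : (T₀ : ℝ) = a / (8 * (C + 1)) := Real.coe_toNNReal _ (by positivity)
  have hT₀0 : 0 < T₀ := Real.toNNReal_pos.2 (by positivity)
  intro hctrl
  have hlt : classicalControllabilityDiameter V W < (T₀ : ℝ≥0∞) := by
    rw [show classicalControllabilityDiameter V W = 0 from hctrl]
    exact_mod_cast hT₀0
  obtain ⟨_, ⟨T, rfl, Υ, hΥ, hreach⟩, hTT₀⟩ := sInf_lt_iff.1 hlt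
  have hTT : (T : ℝ) < T₀ := by exact_mod_cast hTT₀
  obtain ⟨z, hzbox, hzΥ⟩ := (mem_closure_iff_nhds.1 (hΥ (⟨x₀, 0⟩ : CotangentBundle n M)))
    _ (chartBox_mem_nhds (show (0 : ℝ) < a / 4 by positivity) (zero_mem_chartBox x₀ le_rfl))
  have hLT : 2 * C * (T : ℝ) ≤ a / 4 := by
    have h3 : 2 * C * (T : ℝ) ≤ 2 * (C + 1) * (a / (8 * (C + 1))) := by
      rw [← hT₀v]; gcongr; linarith
    have h4 : 2 * ((C : ℝ) + 1) * (a / (8 * (C + 1))) = a / 4 := by field_simp; norm_num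
    linarith
  have hsub := classicalReachableSet_subset_chartBox ha0 hB hL hW0 hLT hzbox
  refine chartBox_ne_univ hn x₀ (a / 2) (univ_subset_iff.1 ?_)
  rw [← hreach z hzΥ]
  refine closure_minimal hsub (isClosed_chartBox fun q hq => (hB q ?_).1)
  exact Metric.closedBall_subset_closedBall (by linarith) hq

end Necessity

lemma eq_zero_of_ιMulti_one_eq_zero {E : Type*} [AddCommGroup E] [Module ℝ E] {v : Fin 1 → E}
    (h : exteriorPower.ιMulti ℝ 1 v = 0) : v 0 = 0 := by
  rw [← exteriorPower.oneEquiv_ιMulti (R := ℝ) v, h, map_zero]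

/-- For a single function, the top-degree form is the differential itself. -/
lemma mvfderiv_eq_zero_of_mem_degeneracySet {M : Type*} [TopologicalSpace M]
    [ChartedSpace (EuclideanSpace ℝ (Fin 1)) M] {W : Fin 1 → M → ℝ} {x : M}
    (hx : x ∈ degeneracySet W) (i : Fin 1) : mvfderiv (𝓡 1) (W i) x = 0 := by
  rw [Subsingleton.elim i 0]
  exact eq_zero_of_ιMulti_one_eq_zero (v := fun i => mvfderiv (𝓡 1) (W i) x) hx

end CotangentControl

theorem mainTheorem3 {n : ℕ} {M : Type*} [EMetricSpace M] [ConnectedSpace M] [CompleteSpace M]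
    [ChartedSpace (EuclideanSpace ℝ (Fin n)) M] [IsManifold (𝓡 n) ∞ M]
    [RiemannianBundle (fun x : M => TangentSpace (𝓡 n) x)]
    [IsContMDiffRiemannianBundle (𝓡 n) ∞ (EuclideanSpace ℝ (Fin n))
      (fun x : M => TangentSpace (𝓡 n) x)]
    [IsRiemannianManifold (𝓡 n) M]
    (V : M → ℝ) (W : Fin n → M → ℝ)
    (hV : ContMDiff (𝓡 n) 𝓘(ℝ, ℝ) 2 V)
    (hW : ∀ i, ContMDiff (𝓡 n) 𝓘(ℝ, ℝ) 2 (W i)) :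
    (interior (degeneracySet W) = ∅ → IsSmallTimeCAControllable V W) ∧
      (n = 1 → IsSmallTimeCAControllable V W → interior (degeneracySet W) = ∅) := by
  refine ⟨CotangentControl.isSmallTimeCAControllable_of_interior_eq_empty hV hW, ?_⟩
  rintro rfl hctrl
  by_contra hne
  obtain ⟨x₀, hx₀⟩ := nonempty_iff_ne_empty.2 hne
  refine CotangentControl.not_isSmallTimeCAControllable one_pos hV hW (x₀ := x₀) ?_ hctrl
  filter_upwards [mem_interior_iff_mem_nhds.1 hx₀] with x hx
  exact CotangentControl.mvfderiv_eq_zero_of_mem_degeneracySet hx
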